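/- Let $d\ge 1$, $U_d:=\mathbb R_+^d\setminus\{0\}$, and let $(d,c,\beta,B,\nu,\mu)$ be admissible parameters of a multi-type CBI process: $c,\beta\in\mathbb R_+^d$; $B=(b_{i,j})\in\mathbb R^{d\times d}$ with $b_{i,j}\ge 0$ for $i\neq j$; $\nu$ is a Borel measure on $U_d$ with $\int_{U_d}(1\wedge\|z\|)\,\nu(dz)<\infty$; $\mu=(\mu_1,\dots,\mu_d)$ are Borel measures on $U_d$ with $\int_{U_d}\bigl[\|z\|\wedge\|z\|^2+\sum_{j\ne i}z_j\bigr]\mu_i(dz)<\infty$. Assume the moment condition $\int_{U_d}\|z\|\mathbf 1_{\{\|z\|\ge1\}}\,\nu(dz)<\infty$. Put $\tilde b_{i,j}:=b_{i,j}+\int_{U_d}(z_i-\delta_{i,j})^+\,\mu_j(dz)$ and $\tilde B:=(\tilde b_{i,j})$. *Definitions.* For a locally compact separable metric space $E$, let $M(E)$ be the space of finite Borel measures on $E$ (with the weak topology), $M(E)^\circ:=M(E)\setminus\{0\}$ and $\kappa(f):=\int_E f\,d\kappa$. A tuple $(E,(R_t),c,\beta,b,B,H_1,H_2)$ is called admissible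 if: $(R_t)$ is the transition semigroup of a conservative Hunt process in $E$, it preserves $C_0(E)$, and $t\mapsto R_tf$ is continuous in the supremum norm for $f\in C_0(E)$; $c\ge0$ and $b$ are bounded continuous functions; $\beta\in M(E)$; $H_1$ is a measure on $M(E)^\circ$ with $\int\kappa(1)\,H_1(d\kappa)<\infty$; $B(x,dy)$ is a bounded kernel on $E$, and $H_2(x,d\kappa)$ is a $\sigma$-finite kernel from $E$ to $M(E)^\circ$ such that the measures $(\kappa(1)\wedge\kappa(1)^2)H_2(x,d\kappa)$ are finite and weakly continuous in $x$, and such that $f\mapsto\int(\kappa(f)\wedge\kappa(f)^2)H_2(\cdot,d\kappa)$ and $f\mapsto\gamma(\cdot,f)$ preserve $C_0(E)^+$, where $\gamma(x,dy):=B(x,dy)+\int\kappa|_{E\setminus\{x\}}(dy)\,H_2(x,d\kappa)$. The immigration superprocess with these parameters is the Markov process on $M(E)$ whose transition semigroup $(Q_t)$ satisfies $\int e^{-\kappa(f)}Q_t(m,d\kappa)=\exp\bigl(-m(V_tf)-\int_0^tI(V_sf)\,ds\bigr)$ for all bounded Borel $f\ge0$, where $V_tf\ge0$ is the locally bounded solution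 of $V_tf(x)=R_tf(x)-\int_0^t\int_E\phi(y,V_sf)\,R_{t-s}(x,dy)\,ds$, with $\phi(x,f)=c(x)f(x)^2+b(x)f(x)-\int f(y)B(x,dy)+\int(e^{-\kappa(f)}-1+\kappa(\{x\})f(x))H_2(x,d\kappa)$ and $I(f)=\beta(f)+\int(1-e^{-\kappa(f)})H_1(d\kappa)$. The multi-type CBI process with parameters $(d,c,\beta,B,\nu,\mu)$ is the Markov process on $\mathbb R_+^d$ with the conservative transition semigroup $(P_t)$ whose generator (limit in the supremum norm) on $C_c^2(\mathbb R_+^d,\mathbb R)$ is $$(\mathcal Af)(x)=\sum_i c_ix_if''_{i,i}(x)+\langle\beta+Bx,f'(x)\rangle+\int_{U_d}(f(x+z)-f(x))\,\nu(dz)+\sum_i x_i\int_{U_d}\bigl(f(x+z)-f(x)-f'_i(x)(1\wedge z_i)\bigr)\mu_i(dz),$$ and whose Laplace transforms are $\int e^{-\langle\lambda,y\rangle}P_t(x,dy)=\exp\bigl(-\langle x,v(t,\lambda)\rangle-\int_0^t\psi(v(s,\lambda))\,ds\bigr)$, $\lambda\in\mathbb R_+^d$, where $v(\cdot,\lambda)$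 is the continuously differentiable $\mathbb R_+^d$-valued solution of $\partial_tv_i=-\varphi_i(v)$, $v(0,\lambda)=\lambda$, with $\varphi_i(\lambda)=c_i\lambda_i^2-\langle Be_i,\lambda\rangle+\int(e^{-\langle\lambda,z\rangle}-1+\lambda_i(1\wedge z_i))\mu_i(dz)$ and $\psi(\lambda)=\langle\beta,\lambda\rangle-\int(e^{-\langle\lambda,z\rangle}-1)\nu(dz)$. *Statement.* (1) The following parameters are admissible for an immigration superprocess: $E=\{1,\dots,d\}$ with the discrete metric, $R_tf=f$, $c(i)=c_i$, $\beta(\{i\})=\beta_i$, $b(i)=-\tilde b_{i,i}$, $B(i,\{i\})=0$ and $B(i,\{j\})=b_{j,i}$ for $i\ne j$, and $H_1$ and $H_2(i,\cdot)$ are the images of $\nu$ and $\mu_i$ under the identification $U_d\cong M(E)^\circ$, $z\mapsto\sum_iz_i\delta_i$. (2) Let $(\Omega,\mathcal F,(\mathcal F_t)_{t\ge0},\mathbb P)$ be a filtered probability space satisfying the usual hypotheses, let $(\mathcal G_t)$ be a filtration with $\mathcal G_t\subseteq\mathcal F_t$ for all $t$ (for instance $\mathcal G_t=\mathcal F_t$,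 or the natural filtration of $Y$), and let $Y$ be an almost surely càdlàg immigration superprocess with the parameters in (1), adapted to and Markov with respect to $(\mathcal G_t)$, with $\mathbb E(Y_0(1))<\infty$. Then $X_t:=(Y_t(\{1\}),\dots,Y_t(\{d\}))^\top$ is a multi-type CBI process with parameters $(d,c,\beta,B,\nu,\mu)$, adapted to and Markov with respect to $(\mathcal G_t)$, and $\mathbb E(\|X_0\|)<\infty$. (3) For all $f\in C^2_c(\mathbb R_+^d,\mathbb R)$ and $x\in\mathbb R_+^d$, all the integrals over $U_d$ in $\mathcal Af(x)$, in $\tilde B$ and in the following formula converge absolutely, and $$(\mathcal Af)(x)=\sum_ic_ix_if''_{i,i}(x)+\sum_ix_i\int_{U_d}\bigl(f(x+z)-f(x)-\langle z,f'(x)\rangle\bigr)\mu_i(dz)+\langle\beta+\tilde Bx,f'(x)\rangle+\int_{U_d}(f(x+z)-f(x))\,\nu(dz).$$ -/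

import Mathlib

open MeasureTheory ProbabilityTheory Filter Topology Set
open scoped NNReal ENNReal ZeroAtInfty BoundedContinuousFunction

universe u

noncomputable section

/-! ### General notions: paths, semigroups, Markov processes, Hunt processes -/

/-- Right-continuous with left limits on `[0, ∞)`. -/
def IsCadlag {S : Type*} [TopologicalSpace S] (x : ℝ≥0 → S) : Prop :=
  ∀ t : ℝ≥0, ContinuousWithinAt x (Ici t) t ∧ ∃ l : S, Tendsto x (𝓝[<] t) (𝓝 l)

/-- A conservative transition semigroup of (Borel) kernels on `S`. -/
structure IsTransitionSemigroup {S : Type*} [MeasurableSpace S]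
    (P : ℝ≥0 → Kernel S S) : Prop where
  markov : ∀ t, IsMarkovKernel (P t)
  zero : P 0 = Kernel.id
  add : ∀ s t, P (s + t) = P t ∘ₖ P s

/-- `X` is a Markov process with respect to the filtration `𝓖`, with transition
semigroup `P`. -/
structure IsMarkovProcess {Ω S : Type*} [mΩ : MeasurableSpace Ω] [MeasurableSpace S]
    (Pr : Measure Ω) (𝓖 : Filtration ℝ≥0 mΩ) (X : ℝ≥0 → Ω → S)
    (P : ℝ≥0 → Kernel S S) : Prop where
  adapted : ∀ t, Measurable[𝓖 t] (X t)
  markov : ∀ (s t : ℝ≥0) (A : Set S), MeasurableSet A →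
    Pr[(X (s + t) ⁻¹' A).indicator (fun _ => (1 : ℝ)) | 𝓖 s]
      =ᵐ[Pr] fun ω => (P t (X s ω)).real A

/-- The usual hypotheses: right continuity, and the initial σ-algebra contains all subsets of
null events (`Pr` of an arbitrary set is the outer measure). -/
structure UsualHypotheses {Ω : Type*} [mΩ : MeasurableSpace Ω] (Pr : Measure Ω)
    (ℱ : Filtration ℝ≥0 mΩ) : Prop where
  right_continuous : ∀ t : ℝ≥0, (⨅ s > t, (ℱ s : MeasurableSpace Ω)) ≤ ℱ t
  complete : ∀ A : Set Ω, Pr A = 0 → MeasurableSet[ℱ 0] A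

/-- `(Ω, 𝒢, (𝒢_t), (ξ_t), (θ_t), (P_x))` is a (conservative) Hunt process with values in `E` and
transition semigroup `R`. The law with initial distribution `m` is `A ↦ ∫ P_x(A) m(dx)`. -/
structure IsHuntProcess {Ω E : Type*} [mΩ : MeasurableSpace Ω] [TopologicalSpace E]
    [MeasurableSpace E] (𝒢 : Filtration ℝ≥0 mΩ) (ξ : ℝ≥0 → Ω → E) (θ : ℝ≥0 → Ω → Ω)
    (P : E → Measure Ω) (R : ℝ≥0 → Kernel E E) : Prop where
  prob : ∀ x, IsProbabilityMeasure (P x)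
  universally_measurable : ∀ A, MeasurableSet A → ∀ m : FiniteMeasure E,
    AEMeasurable (fun x => P x A) (m : Measure E)
  right_continuous : ∀ t : ℝ≥0, (⨅ s > t, (𝒢 s : MeasurableSpace Ω)) ≤ 𝒢 t
  /-- The filtration is augmented by the sets that are null for each initial distribution. -/
  augmented : ∀ (t : ℝ≥0) (A : Set Ω),
    (∀ m : FiniteMeasure E, ∃ A' N : Set Ω, MeasurableSet[𝒢 t] A' ∧ MeasurableSet N ∧
      ∫⁻ x, P x N ∂(m : Measure E) = 0 ∧ symmDiff A A' ⊆ N) → MeasurableSet[𝒢 t] A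
  adapted : ∀ t, Measurable[𝒢 t] (ξ t)
  shift : ∀ s t ω, ξ s (θ t ω) = ξ (s + t) ω
  normal : ∀ x, ∀ᵐ ω ∂(P x), ξ 0 ω = x
  cadlag : ∀ ω, IsCadlag fun t => ξ t ω
  strong_markov : ∀ (T : Ω → WithTop ℝ≥0) (hT : IsStoppingTime 𝒢 T) (A : Set Ω),
    MeasurableSet[hT.measurableSpace] A → ∀ (x : E) (s : ℝ≥0) (f : E → ℝ≥0∞), Measurable f →
      ∫⁻ ω in A ∩ {ω | T ω ≠ ⊤}, f (ξ ((T ω).untopD 0 + s) ω) ∂(P x)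
        = ∫⁻ ω in A ∩ {ω | T ω ≠ ⊤}, ∫⁻ y, f y ∂(R s (ξ ((T ω).untopD 0) ω)) ∂(P x)
  quasi_left_continuous : ∀ (T : ℕ → Ω → WithTop ℝ≥0) (T' : Ω → WithTop ℝ≥0),
    (∀ n, IsStoppingTime 𝒢 (T n)) → (∀ ω, Monotone fun n => T n ω) →
    (∀ ω, IsLUB (range fun n => T n ω) (T' ω)) →
    ∀ x, ∀ᵐ ω ∂(P x), T' ω ≠ ⊤ →
      Tendsto (fun n => ξ ((T n ω).untopD 0) ω) atTop (𝓝 (ξ ((T' ω).untopD 0) ω))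

/-! ### Immigration superprocesses -/

/-- `M(E)°`: the nonzero finite Borel measures on `E`; `FiniteMeasure E` carries the topology of
weak convergence and the σ-algebra generated by the evaluations `κ ↦ κ(A)`, which is the Borel
σ-algebra when `E` is separable and metrizable. -/
abbrev MPos (E : Type u) [MeasurableSpace E] : Type u := {κ : FiniteMeasure E // κ ≠ 0}

/-- `κ(f) = ∫ f dκ`. -/
def pairing {E : Type u} [MeasurableSpace E] (κ : FiniteMeasure E) (f : E → ℝ) : ℝ :=
  ∫ y, f y ∂(κ : Measure E)

/-- The data `(R, c, β, b, B, H₁, H₂)` on the space `E`. -/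
structure ISParams (E : Type u) [MeasurableSpace E] where
  R : ℝ≥0 → Kernel E E
  c : E → ℝ
  β : FiniteMeasure E
  b : E → ℝ
  B : Kernel E E
  H₁ : Measure (MPos E)
  H₂ : Kernel E (MPos E)

namespace ISParams

variable {E : Type u} [MeasurableSpace E] (q : ISParams E)

/-- `γ(x, f)` for `f ≥ 0`, where `γ(x, dy) = B(x, dy) + ∫ κ_x(dy) H₂(x, dκ)` and `κ_x` is the
restriction of `κ` to `E \ {x}`. -/
def gamma (x : E) (f : E → ℝ) : ℝ≥0∞ :=
  ∫⁻ y, ENNReal.ofReal (f y) ∂(q.B x) +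
    ∫⁻ κ, ∫⁻ y in {x}ᶜ, ENNReal.ofReal (f y) ∂(κ.1 : Measure E) ∂(q.H₂ x)

/-- Admissible parameters of immigration superprocesses. -/
structure IsAdmissible [TopologicalSpace E] : Prop where
  metrizable : TopologicalSpace.MetrizableSpace E
  separable : TopologicalSpace.SeparableSpace E
  locally_compact : LocallyCompactSpace E
  borel : BorelSpace E
  semigroup : IsTransitionSemigroup q.R
  hunt : ∃ (Ω : Type u) (mΩ : MeasurableSpace Ω) (𝒢 : Filtration ℝ≥0 mΩ) (ξ : ℝ≥0 → Ω → E)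
    (θ : ℝ≥0 → Ω → Ω) (P : E → Measure Ω), IsHuntProcess 𝒢 ξ θ P q.R
  /-- `R_t` preserves `C₀(E)` and `t ↦ R_t f` is continuous in the supremum norm. -/
  feller : ∀ f : C₀(E, ℝ), ∃ v : ℝ≥0 → C₀(E, ℝ), Continuous v ∧
    ∀ t x, v t x = ∫ y, f y ∂(q.R t x)
  c_continuous : Continuous q.c
  c_nonneg : ∀ x, 0 ≤ q.c x
  c_bounded : ∃ K, ∀ x, |q.c x| ≤ K
  b_continuous : Continuous q.b
  b_bounded : ∃ K, ∀ x, |q.b x| ≤ K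
  /-- `κ(1) H₁(dκ)` is a finite measure. -/
  H₁_moment : ∫⁻ κ, (κ.1.mass : ℝ≥0∞) ∂q.H₁ < ∞
  B_bounded : ∃ K : ℝ≥0, ∀ x, q.B x univ ≤ K
  H₂_sigmaFinite : ∀ x, SigmaFinite (q.H₂ x)
  /-- The measures `(κ(1) ∧ κ(1)²) H₂(x, dκ)` are finite and weakly continuous in `x`. -/
  H₂_finite : ∀ x, ∫⁻ κ, ((min κ.1.mass (κ.1.mass ^ 2) : ℝ≥0) : ℝ≥0∞) ∂(q.H₂ x) < ∞
  H₂_continuous : ∀ g : MPos E →ᵇ ℝ,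
    Continuous fun x => ∫ κ, g κ * (min κ.1.mass (κ.1.mass ^ 2) : ℝ≥0) ∂(q.H₂ x)
  /-- `f ↦ ∫ (κ(f) ∧ κ(f)²) H₂(·, dκ)` preserves `C₀(E)⁺`. -/
  H₂_preserves : ∀ f : C₀(E, ℝ), (∀ x, 0 ≤ f x) → ∃ g : C₀(E, ℝ), ∀ x, 0 ≤ g x ∧
    ∫⁻ κ, ENNReal.ofReal (min (pairing κ.1 f) (pairing κ.1 f ^ 2)) ∂(q.H₂ x)
      = ENNReal.ofReal (g x)
  /-- `f ↦ γ(·, f)` preserves `C₀(E)⁺`. -/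
  gamma_preserves : ∀ f : C₀(E, ℝ), (∀ x, 0 ≤ f x) → ∃ g : C₀(E, ℝ), ∀ x, 0 ≤ g x ∧
    q.gamma x f = ENNReal.ofReal (g x)

/-- The branching mechanism `ϕ(x, f)`. -/
def phi (x : E) (f : E → ℝ) : ℝ :=
  q.c x * f x ^ 2 + q.b x * f x - ∫ y, f y ∂(q.B x) +
    ∫ κ, (Real.exp (-pairing κ.1 f) - 1 + (κ.1 {x} : ℝ) * f x) ∂(q.H₂ x)

/-- The immigration functional `I(f)`. -/
def immigration (f : E → ℝ) : ℝ :=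
  pairing q.β f + ∫ κ, (1 - Real.exp (-pairing κ.1 f)) ∂q.H₁

/-- `V t = V_t f`, `t ≥ 0`, is a nonnegative locally bounded solution of
`V_t f(x) = R_t f(x) - ∫_0^t ∫ ϕ(y, V_s f) R_{t-s}(x, dy) ds`. -/
structure IsCumulant (f : E → ℝ) (V : ℝ → E → ℝ) : Prop where
  measurable : Measurable (Function.uncurry V)
  nonneg : ∀ t, 0 ≤ t → ∀ x, 0 ≤ V t x
  locally_bounded : ∀ T : ℝ, ∃ K, ∀ t ∈ Icc 0 T, ∀ x, V t x ≤ K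
  equation : ∀ t, 0 ≤ t → ∀ x, V t x = ∫ y, f y ∂(q.R t.toNNReal x) -
    ∫ s in (0 : ℝ)..t, ∫ y, q.phi y (V s) ∂(q.R (t - s).toNNReal x)

/-- `Q` is the transition semigroup on `M(E)` of the immigration superprocess with parameters
`q`, determined by its Laplace functionals
`∫ e^{-κ(f)} Q_t(μ, dκ) = exp(-μ(V_t f) - ∫_0^t I(V_s f) ds)`, `f ∈ B(E)⁺`. -/
structure IsSemigroup (Q : ℝ≥0 → Kernel (FiniteMeasure E) (FiniteMeasure E)) : Prop where
  semigroup : IsTransitionSemigroup Q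
  laplace : ∀ f : E → ℝ, Measurable f → (∀ x, 0 ≤ f x) → (∃ K, ∀ x, f x ≤ K) →
    ∃ V : ℝ → E → ℝ, q.IsCumulant f V ∧ ∀ (t : ℝ≥0) (μ : FiniteMeasure E),
      ∫ κ, Real.exp (-pairing κ f) ∂(Q t μ)
        = Real.exp (-pairing μ (V t) - ∫ s in (0 : ℝ)..t, q.immigration (V s))

/-- `Y` is an immigration superprocess with parameters `q` (Markov with respect to `𝓖`). -/
def IsSuperprocess {Ω : Type*} [mΩ : MeasurableSpace Ω] (Pr : Measure Ω)
    (𝓖 : Filtration ℝ≥0 mΩ) (Y : ℝ≥0 → Ω → FiniteMeasure E) : Prop :=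
  ∃ Q, q.IsSemigroup Q ∧ IsMarkovProcess Pr 𝓖 Y Q

end ISParams

/-! ### Multi-type CBI processes -/

/-- `ℝ_+^d` as a subset of Euclidean space. -/
def orthant (d : ℕ) : Set (EuclideanSpace ℝ (Fin d)) := {x | ∀ i, 0 ≤ x i}

/-- The state space `ℝ_+^d`. -/
abbrev Orthant (d : ℕ) : Type := orthant d

/-- `U_d = ℝ_+^d \ {0}`. -/
abbrev UPos (d : ℕ) : Type := {z : EuclideanSpace ℝ (Fin d) // z ∈ orthant d ∧ z ≠ 0}

/-- `C²_c(ℝ_+^d, ℝ)`: twice continuously differentiable on `ℝ_+^d` (up to the boundary), with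
compact support in `ℝ_+^d`. Only the values on the orthant matter. -/
structure IsC2c {d : ℕ} (f : EuclideanSpace ℝ (Fin d) → ℝ) : Prop where
  smooth : ContDiffOn ℝ 2 f (orthant d)
  support : ∃ K : Set (EuclideanSpace ℝ (Fin d)), IsCompact K ∧ ∀ x ∈ orthant d, x ∉ K → f x = 0

/-- The first order partial derivative `f'_i` on the orthant. -/
def pd {d : ℕ} (f : EuclideanSpace ℝ (Fin d) → ℝ) (i : Fin d)
    (x : EuclideanSpace ℝ (Fin d)) : ℝ :=
  fderivWithin ℝ f (orthant d) x (EuclideanSpace.single i 1)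

/-- The data `(c, β, B, ν, μ)` of dimension `d`. -/
structure CBIParams (d : ℕ) where
  c : Fin d → ℝ
  β : Fin d → ℝ
  B : Matrix (Fin d) (Fin d) ℝ
  ν : Measure (UPos d)
  μ : Fin d → Measure (UPos d)

namespace CBIParams

variable {d : ℕ} (p : CBIParams d)

/-- Admissible parameters of multi-type CBI processes. -/
structure IsAdmissible : Prop where
  one_le_dim : 1 ≤ d
  c_nonneg : ∀ i, 0 ≤ p.c i
  β_nonneg : ∀ i, 0 ≤ p.β i
  B_nonneg : ∀ i j, i ≠ j → 0 ≤ p.B i j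
  ν_int : ∫⁻ z, ENNReal.ofReal (min 1 ‖z.1‖) ∂p.ν < ∞
  μ_int : ∀ i, ∫⁻ z, ENNReal.ofReal
    (min ‖z.1‖ (‖z.1‖ ^ 2) + ∑ j ∈ Finset.univ.erase i, z.1 j) ∂(p.μ i) < ∞

/-- `∫ ‖z‖ 1_{‖z‖ ≥ 1} ν(dz) < ∞`. -/
def MomentCondition : Prop := ∫⁻ z in {z | 1 ≤ ‖z.1‖}, ENNReal.ofReal ‖z.1‖ ∂p.ν < ∞

/-- `b̃_{i,j} = b_{i,j} + ∫ (z_i - δ_{i,j})⁺ μ_j(dz)`. -/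
def Btilde (i j : Fin d) : ℝ :=
  p.B i j + ∫ z, max (z.1 i - if i = j then 1 else 0) 0 ∂(p.μ j)

/-- The branching mechanism `φ_i(λ)`. -/
def phi (i : Fin d) (l : EuclideanSpace ℝ (Fin d)) : ℝ :=
  p.c i * l i ^ 2 - ∑ j, p.B j i * l j +
    ∫ z, (Real.exp (-∑ j, l j * z.1 j) - 1 + l i * min 1 (z.1 i)) ∂(p.μ i)

/-- The immigration mechanism `ψ(λ)`. -/
def psi (l : EuclideanSpace ℝ (Fin d)) : ℝ :=
  ∑ j, p.β j * l j - ∫ z, (Real.exp (-∑ j, l j * z.1 j) - 1) ∂p.ν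

/-- The infinitesimal generator of the CBI process on `C²_c(ℝ_+^d, ℝ)`. -/
def gen (f : EuclideanSpace ℝ (Fin d) → ℝ) (x : EuclideanSpace ℝ (Fin d)) : ℝ :=
  ∑ i, p.c i * x i * pd (pd f i) i x
    + ∑ i, (p.β i + ∑ j, p.B i j * x j) * pd f i x
    + ∫ z, (f (x + z.1) - f x) ∂p.ν
    + ∑ i, x i * ∫ z, (f (x + z.1) - f x - pd f i x * min 1 (z.1 i)) ∂(p.μ i)

/-- The alternative form of the generator. -/
def genAlt (f : EuclideanSpace ℝ (Fin d) → ℝ) (x : EuclideanSpace ℝ (Fin d)) : ℝ :=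
  ∑ i, p.c i * x i * pd (pd f i) i x
    + ∑ i, x i * ∫ z, (f (x + z.1) - f x - ∑ j, z.1 j * pd f j x) ∂(p.μ i)
    + ∑ i, (p.β i + ∑ j, p.Btilde i j * x j) * pd f i x
    + ∫ z, (f (x + z.1) - f x) ∂p.ν

/-- `v`, on `[0, ∞)`, is the continuously differentiable `ℝ_+^d`-valued solution of
`∂_t v_i = -φ_i(v)`, `v(0) = l`. -/
structure IsCumulant (l : EuclideanSpace ℝ (Fin d)) (v : ℝ → EuclideanSpace ℝ (Fin d)) :
    Prop where
  mem_orthant : ∀ t, 0 ≤ t → v t ∈ orthant d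
  initial : v 0 = l
  smooth : ContDiffOn ℝ 1 v (Ici 0)
  equation : ∀ t, 0 ≤ t →
    HasDerivWithinAt v (WithLp.toLp 2 fun i => -p.phi i (v t)) (Ici 0) t

/-- `P` is the transition semigroup on `ℝ_+^d` of the multi-type CBI process with parameters `p`:
it is conservative, its generator (limit in the supremum norm) is `p.gen` on `C²_c`, and it has
the corresponding Laplace transforms. -/
structure IsSemigroup (P : ℝ≥0 → Kernel (Orthant d) (Orthant d)) : Prop where
  semigroup : IsTransitionSemigroup P
  generator : ∀ f : EuclideanSpace ℝ (Fin d) → ℝ, IsC2c f →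
    TendstoUniformly
      (fun (t : ℝ≥0) (x : Orthant d) => ((∫ y : Orthant d, f y.1 ∂(P t x)) - f x.1) / (t : ℝ))
      (fun x => p.gen f x.1) (𝓝[>] 0)
  laplace : ∀ l : Orthant d, ∃ v : ℝ → EuclideanSpace ℝ (Fin d), p.IsCumulant l.1 v ∧
    ∀ (t : ℝ≥0) (x : Orthant d),
      ∫ y : Orthant d, Real.exp (-∑ j, l.1 j * y.1 j) ∂(P t x)
        = Real.exp (-∑ j, x.1 j * v t j - ∫ s in (0 : ℝ)..t, p.psi (v s))

/-- `X` is a multi-type CBI process with parameters `p` (Markov with respect to `𝓖`). -/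
def IsCBI {Ω : Type*} [mΩ : MeasurableSpace Ω] (Pr : Measure Ω)
    (𝓖 : Filtration ℝ≥0 mΩ) (X : ℝ≥0 → Ω → Orthant d) : Prop :=
  ∃ P, p.IsSemigroup P ∧ IsMarkovProcess Pr 𝓖 X P

end CBIParams

/-! ### The identification of `M({1, …, d})` with `ℝ_+^d` -/

/-- The finite measure on `{1, …, d}` with masses `x_i` (for `x ∈ ℝ_+^d`). -/
def ofVec {d : ℕ} (x : Fin d → ℝ) : FiniteMeasure (Fin d) :=
  ⟨∑ i, (x i).toNNReal • Measure.dirac i, inferInstance⟩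

/-- The vector `(κ({1}), …, κ({d}))`. -/
def toVec {d : ℕ} (κ : FiniteMeasure (Fin d)) : Orthant d :=
  ⟨WithLp.toLp 2 fun i => (κ {i} : ℝ), fun i => (κ {i}).2⟩

theorem ofVec_toMeasure_apply {d : ℕ} (x : Fin d → ℝ) (A : Set (Fin d)) :
    (ofVec x : Measure (Fin d)) A
      = ∑ i, ((x i).toNNReal : ℝ≥0∞) * A.indicator 1 i := by
  change (∑ i, (x i).toNNReal • Measure.dirac i : Measure (Fin d)) A = _
  rw [Measure.finsetSum_apply]
  refine Finset.sum_congr rfl fun i _ => ?_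
  rw [Measure.smul_apply, Measure.dirac_apply' _ (MeasurableSet.of_discrete)]
  rfl

theorem ofVec_singleton {d : ℕ} (x : Fin d → ℝ) (i : Fin d) :
    ofVec x {i} = (x i).toNNReal := by
  have h : ((ofVec x {i} : ℝ≥0) : ℝ≥0∞) = (x i).toNNReal := by
    rw [FiniteMeasure.ennreal_coeFn_eq_coeFn_toMeasure, ofVec_toMeasure_apply,
      Finset.sum_eq_single i]
    · simp
    · intro j _ hj
      simp [hj]
    · simp
  exact_mod_cast h

theorem ofVec_ne_zero {d : ℕ} (z : UPos d) : ofVec (fun i => z.1 i) ≠ 0 := by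
  intro h
  apply z.2.2
  ext i
  have h1 : ofVec (fun i => z.1 i) {i} = 0 := by rw [h]; rfl
  rw [ofVec_singleton, Real.toNNReal_eq_zero] at h1
  exact le_antisymm h1 (z.2.1 i)

/-- The identification of `U_d` with `M({1, …, d})°`. -/
def uToM {d : ℕ} (z : UPos d) : MPos (Fin d) := ⟨ofVec fun i => z.1 i, ofVec_ne_zero z⟩

theorem measurable_uToM {d : ℕ} : Measurable (uToM (d := d)) := by
  refine Measurable.subtype_mk (Measurable.subtype_mk ?_)
  refine Measure.measurable_of_measurable_coe _ fun A _ => ?_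
  have h : ∀ z : UPos d, (∑ i, (z.1 i).toNNReal • Measure.dirac i : Measure (Fin d)) A
      = ∑ i, ((z.1 i).toNNReal : ℝ≥0∞) * A.indicator 1 i :=
    fun z => ofVec_toMeasure_apply _ A
  simp only [h]
  fun_prop

/-- The immigration superprocess parameters on the discrete space `{1, …, d}` attached to the
CBI parameters `p`. -/
def CBIParams.toIS {d : ℕ} (p : CBIParams d) : ISParams (Fin d) where
  R := fun _ => Kernel.id
  c := p.c
  β := ofVec p.β
  b := fun i => -p.Btilde i i
  B := ⟨fun i => (ofVec fun j => if j = i then 0 else p.B j i : Measure (Fin d)),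
    measurable_of_finite _⟩
  H₁ := p.ν.map uToM
  H₂ := ⟨fun i => (p.μ i).map uToM, measurable_of_finite _⟩

end

/-!
The superprocess parameters live on a finite discrete space without motion, so their admissibility
is a matter of finiteness of Lévy integrals, and the rewriting of the generator is a change of
compensator: `1 ∧ z_i` and `⟨z, f'⟩` differ by the functions whose integrals define `B̃ - B`
(`IsC2b.branching_eq_taylor_add`). The substance is that the coordinates of the superprocess form
a CBI process, that is, that the transported semigroup `P` has the CBI Laplace transforms and that
its generator, as a uniform limit, is `p.gen` on `C²_c`.

For the Laplace transforms, the two branching mechanisms agree (`toIS_phi`). The cumulant equation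
is an integrated ordinary differential equation with continuous right-hand side, whose measurable
locally bounded solutions are `C¹` (`isCumulant_of_toIS`).

The generator is obtained without polynomial or Fourier approximation in `C²`. Let `D` be the span
of the exponentials `e_l(x) = e^{-⟨l, x⟩}` with all `l_i > 0`.
* On `D`, `P_t u = u + t · gen u + o(t)` uniformly (`expo_expansion`), and `D` is invariant under
  `P`, because cumulants started in the open orthant stay there (`cumulant_pos`).
* By Stone–Weierstrass on the one point compactification, `D` is dense in the continuous functions
  vanishing at infinity (`exists_expoGraph_fst_near`). By invariance, `D` lies in the closure of
  `(1 - gen) D` (`exists_expoGraph_sub_near_fst`).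
* The operator `gen` satisfies the positive maximum principle on bounded `C²` functions vanishing
  at infinity (`gen_nonpos_of_isMaxOn`), hence `‖u‖ ≤ ‖u - gen u‖`.

For `f ∈ C²_c` the function `f - gen f` is continuous with compact support, since jumps only
increase the coordinates. So there are `u_n ∈ D` with `u_n - gen u_n → f - gen f` uniformly, and
dissipativity gives `u_n → f` and `gen u_n → gen f` (`exists_expoGraph_near`). The mean value
inequality for `t ↦ P_t u_n` passes to the limit and, with strong continuity, gives
`(P_t f - f) / t → gen f` uniformly.
-/

/-! ### Coordinates in the orthant -/

theorem coord_le_norm {d : ℕ} (x : EuclideanSpace ℝ (Fin d)) (i : Fin d) : x i ≤ ‖x‖ :=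
  (le_abs_self _).trans (by simpa using PiLp.norm_apply_le x i)

theorem norm_le_sum_abs {d : ℕ} (x : EuclideanSpace ℝ (Fin d)) : ‖x‖ ≤ ∑ i, |x i| := by
  rw [EuclideanSpace.norm_eq, Real.sqrt_le_left (Finset.sum_nonneg fun i _ => abs_nonneg _)]
  simpa using Finset.sum_sq_le_sq_sum_of_nonneg (s := Finset.univ) (f := fun i => |x i|)
    fun i _ => abs_nonneg _

theorem norm_le_sum_coord {d : ℕ} {x : EuclideanSpace ℝ (Fin d)} (hx : x ∈ orthant d) :
    ‖x‖ ≤ ∑ i, x i :=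
  (norm_le_sum_abs x).trans_eq (Finset.sum_congr rfl fun i _ => abs_of_nonneg (hx i))

theorem sum_coord_le {d : ℕ} (x : EuclideanSpace ℝ (Fin d)) : ∑ i, x i ≤ d * ‖x‖ := by
  simpa using Finset.sum_le_card_nsmul Finset.univ (fun i => x i) ‖x‖
    fun i _ => coord_le_norm x i

theorem add_mem_orthant {d : ℕ} {x y : EuclideanSpace ℝ (Fin d)} (hx : x ∈ orthant d)
    (hy : y ∈ orthant d) : x + y ∈ orthant d := fun i => add_nonneg (hx i) (hy i)

/-- On the orthant the Euclidean norm is monotone. -/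
theorem norm_le_norm_add {d : ℕ} {x y : EuclideanSpace ℝ (Fin d)} (hx : x ∈ orthant d)
    (hy : y ∈ orthant d) : ‖x‖ ≤ ‖x + y‖ := by
  rw [EuclideanSpace.norm_eq, EuclideanSpace.norm_eq]
  refine Real.sqrt_le_sqrt (Finset.sum_le_sum fun i _ => ?_)
  rw [Real.norm_of_nonneg (hx i), Real.norm_of_nonneg (add_mem_orthant hx hy i)]
  exact pow_le_pow_left₀ (hx i) (le_add_of_nonneg_right (hy i)) 2

theorem isClosed_orthant (d : ℕ) : IsClosed (orthant d) := by
  have : orthant d = ⋂ i, {x | 0 ≤ x i} := by ext; simp [orthant]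
  rw [this]
  exact isClosed_iInter fun i => isClosed_le continuous_const (by fun_prop)

theorem tendsto_norm_cocompact_orthant (d : ℕ) :
    Tendsto (fun x : Orthant d => ‖x.1‖) (cocompact (Orthant d)) atTop :=
  tendsto_norm_cocompact_atTop.comp
    (isClosed_orthant d).isClosedEmbedding_subtypeVal.tendsto_cocompact

theorem convex_orthant (d : ℕ) : Convex ℝ (orthant d) := by
  intro x hx y hy a b ha hb _ i
  simpa using add_nonneg (mul_nonneg ha (hx i)) (mul_nonneg hb (hy i))

theorem uniqueDiffOn_orthant (d : ℕ) : UniqueDiffOn ℝ (orthant d) := by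
  refine uniqueDiffOn_convex (convex_orthant d)
    ⟨WithLp.toLp 2 fun _ => 1, mem_interior.2 ⟨⋂ i, {x | 0 < x i}, ?_, ?_, ?_⟩⟩
  · exact fun x hx i => (mem_iInter.1 hx i).le
  · exact isOpen_iInter_of_finite fun i => isOpen_lt continuous_const (by fun_prop)
  · simp

/-! ### Integrability against the Lévy measures -/

namespace CBIParams

variable {d : ℕ} {p : CBIParams d}

theorem IsAdmissible.integrable_min (hp : p.IsAdmissible) (i : Fin d) :
    Integrable (fun z : UPos d => min ‖z.1‖ (‖z.1‖ ^ 2)) (p.μ i) := by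
  refine (lintegral_ofReal_ne_top_iff_integrable (by fun_prop)
    (ae_of_all _ fun z => by positivity)).1 (ne_top_of_le_ne_top (hp.μ_int i).ne ?_)
  refine lintegral_mono fun z => ENNReal.ofReal_le_ofReal ?_
  exact le_add_of_nonneg_right (Finset.sum_nonneg fun j _ => z.2.1 j)

theorem IsAdmissible.integrable_coord (hp : p.IsAdmissible) {i j : Fin d} (h : j ≠ i) :
    Integrable (fun z : UPos d => z.1 j) (p.μ i) := by
  refine (lintegral_ofReal_ne_top_iff_integrable (by fun_prop)
    (ae_of_all _ fun z => z.2.1 j)).1 (ne_top_of_le_ne_top (hp.μ_int i).ne ?_)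
  refine lintegral_mono fun z => ENNReal.ofReal_le_ofReal ?_
  have : z.1 j ≤ ∑ k ∈ Finset.univ.erase i, z.1 k :=
    Finset.single_le_sum (f := fun k => z.1 k) (fun k _ => z.2.1 k)
      (Finset.mem_erase.2 ⟨h, Finset.mem_univ j⟩)
  have h0 : 0 ≤ min ‖z.1‖ (‖z.1‖ ^ 2) := by positivity
  linarith

theorem max_coord_sub_one_le {z : EuclideanSpace ℝ (Fin d)} (i : Fin d) :
    max (z i - 1) 0 ≤ min ‖z‖ (‖z‖ ^ 2) := by
  have h := coord_le_norm z i
  refine max_le (le_min (by linarith) ?_) (by positivity)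
  nlinarith [sq_nonneg (‖z‖ - 1)]

theorem IsAdmissible.integrable_max (hp : p.IsAdmissible) (i j : Fin d) :
    Integrable (fun z : UPos d => max (z.1 i - if i = j then 1 else 0) 0) (p.μ j) := by
  by_cases h : i = j
  · subst h
    simp only [if_true]
    refine (hp.integrable_min i).mono' (by fun_prop) (ae_of_all _ fun z => ?_)
    rw [Real.norm_of_nonneg (le_max_right _ _)]
    exact max_coord_sub_one_le i
  · simp only [h, if_false, sub_zero]
    exact (hp.integrable_coord h).congr (ae_of_all _ fun z => (max_eq_left (z.2.1 i)).symm)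

theorem IsAdmissible.integrable_norm (hp : p.IsAdmissible) (hmom : p.MomentCondition) :
    Integrable (fun z : UPos d => ‖z.1‖) p.ν := by
  refine (lintegral_ofReal_ne_top_iff_integrable (by fun_prop)
    (ae_of_all _ fun z => norm_nonneg _)).1 (ne_top_of_le_ne_top
      (ENNReal.add_lt_top.2 ⟨hp.ν_int, hmom⟩).ne ?_)
  rw [← lintegral_indicator (measurableSet_le measurable_const (by fun_prop)),
    ← lintegral_add_left (by fun_prop)]
  refine lintegral_mono fun z => ?_
  by_cases h : 1 ≤ ‖z.1‖
  · rw [indicator_of_mem (by exact h)]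
    exact le_add_self
  · rw [min_eq_right (not_le.1 h).le]
    exact le_self_add

theorem IsAdmissible.integrable_min_one (hp : p.IsAdmissible) :
    Integrable (fun z : UPos d => min 1 ‖z.1‖) p.ν :=
  (lintegral_ofReal_ne_top_iff_integrable (by fun_prop)
    (ae_of_all _ fun z => by positivity)).1 hp.ν_int.ne

end CBIParams

/-! ### Finite measures on `{1, …, d}` -/

theorem pairing_fin {d : ℕ} (κ : FiniteMeasure (Fin d)) (f : Fin d → ℝ) :
    pairing κ f = ∑ i, (κ {i} : ℝ) * f i := by
  rw [pairing, integral_fintype (μ := (κ : Measure (Fin d))) (Integrable.of_finite)]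
  rfl

theorem pairing_ofVec {d : ℕ} {x : EuclideanSpace ℝ (Fin d)} (hx : x ∈ orthant d)
    (f : Fin d → ℝ) : pairing (ofVec fun i => x i) f = ∑ i, x i * f i := by
  rw [pairing_fin]
  exact Finset.sum_congr rfl fun i _ => by rw [ofVec_singleton, Real.coe_toNNReal _ (hx i)]

theorem mass_fin {d : ℕ} (κ : FiniteMeasure (Fin d)) : κ.mass = ∑ i, κ {i} := by
  have := pairing_fin κ (fun _ => 1)
  simp only [pairing, integral_const, smul_eq_mul, mul_one] at this
  refine NNReal.coe_injective (Eq.trans ?_ (this.trans (NNReal.coe_sum _ _).symm))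
  rfl

theorem mass_ofVec {d : ℕ} {x : EuclideanSpace ℝ (Fin d)} (hx : x ∈ orthant d) :
    ((ofVec fun i => x i).mass : ℝ) = ∑ i, x i := by
  rw [mass_fin, NNReal.coe_sum]
  exact Finset.sum_congr rfl fun i _ => by rw [ofVec_singleton, Real.coe_toNNReal _ (hx i)]

theorem FiniteMeasure.ext_singleton {d : ℕ} {κ κ' : FiniteMeasure (Fin d)}
    (h : ∀ i, κ {i} = κ' {i}) : κ = κ' := by
  refine Subtype.ext (Measure.ext_of_singleton fun i => ?_)
  have := congrArg ((↑) : ℝ≥0 → ℝ≥0∞) (h i)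
  rwa [FiniteMeasure.ennreal_coeFn_eq_coeFn_toMeasure,
    FiniteMeasure.ennreal_coeFn_eq_coeFn_toMeasure] at this

theorem ofVec_toVec {d : ℕ} (κ : FiniteMeasure (Fin d)) :
    ofVec (fun i => (toVec κ).1 i) = κ := by
  refine FiniteMeasure.ext_singleton fun i => ?_
  rw [ofVec_singleton]
  simp [toVec]

theorem toVec_ofVec {d : ℕ} (x : Orthant d) : toVec (ofVec fun i => x.1 i) = x := by
  refine Subtype.ext ?_
  ext i
  simp [toVec, ofVec_singleton, x.2 i]

theorem measurable_apply_fin {d : ℕ} (i : Fin d) :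
    Measurable fun κ : FiniteMeasure (Fin d) => (κ {i} : ℝ) := by
  have h : Measurable fun κ : FiniteMeasure (Fin d) => (κ : Measure (Fin d)) {i} :=
    (Measure.measurable_coe (measurableSet_singleton i)).comp measurable_subtype_coe
  exact h.ennreal_toReal

theorem measurable_toVec {d : ℕ} : Measurable (toVec (d := d)) := by
  refine Measurable.subtype_mk ?_
  exact (PiLp.continuous_toLp 2 _).measurable.comp (measurable_pi_lambda _ measurable_apply_fin)

theorem measurable_ofVec {d : ℕ} : Measurable fun x : Orthant d => ofVec fun i => x.1 i := by
  refine Measurable.subtype_mk (Measure.measurable_of_measurable_coe _ fun A _ => ?_)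
  have h : ∀ x : Orthant d, (∑ i, (x.1 i).toNNReal • Measure.dirac i : Measure (Fin d)) A
      = ∑ i, ((x.1 i).toNNReal : ℝ≥0∞) * A.indicator 1 i :=
    fun x => ofVec_toMeasure_apply _ A
  simp only [h]
  fun_prop

theorem measurable_pairing_fin {d : ℕ} (f : Fin d → ℝ) :
    Measurable fun κ : FiniteMeasure (Fin d) => pairing κ f := by
  simp only [pairing_fin]
  exact Finset.measurable_sum _ fun i _ => (measurable_apply_fin i).mul_const _

theorem measurable_mass_fin {d : ℕ} :
    Measurable fun κ : FiniteMeasure (Fin d) => (κ.mass : ℝ) := by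
  simp only [mass_fin, NNReal.coe_sum]
  exact Finset.measurable_sum _ fun i _ => measurable_apply_fin i

theorem norm_toVec_le_mass {d : ℕ} (κ : FiniteMeasure (Fin d)) : ‖(toVec κ).1‖ ≤ κ.mass := by
  refine (norm_le_sum_coord (toVec κ).2).trans_eq ?_
  rw [mass_fin, NNReal.coe_sum]
  rfl

/-! ### Admissibility of the superprocess parameters -/

/-- The constant paths in a finite discrete space form a Hunt process. -/
theorem exists_huntProcess_id (d : ℕ) : ∃ (Ω : Type) (mΩ : MeasurableSpace Ω)
    (𝒢 : Filtration ℝ≥0 mΩ) (ξ : ℝ≥0 → Ω → Fin d) (θ : ℝ≥0 → Ω → Ω) (P : Fin d → Measure Ω),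
    IsHuntProcess 𝒢 ξ θ P (fun _ => Kernel.id) := by
  refine ⟨Fin d, ⊤, ⟨fun _ => ⊤, fun _ _ _ => le_rfl, fun _ => le_rfl⟩, fun _ ω => ω,
    fun _ ω => ω, fun x => Measure.dirac x, ?_⟩
  constructor
  · intro x; infer_instance
  · intro A _ m; exact (measurable_of_finite _).aemeasurable
  · intro t; exact le_top
  · intro t A _; trivial
  · intro t; exact measurable_of_finite _
  · intro s t ω; rfl
  · intro x; rw [ae_dirac_eq]; rfl
  · intro ω t; exact ⟨continuousWithinAt_const, ω, tendsto_const_nhds⟩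
  · intro T hT A _ x s f hf
    refine lintegral_congr fun ω => ?_
    rw [Kernel.id_apply, lintegral_dirac]
  · intro T T' _ _ _ x
    exact ae_of_all _ fun ω _ => tendsto_const_nhds

namespace CBIParams

variable {d : ℕ} {p : CBIParams d}

theorem toIS_H₂ (i : Fin d) : p.toIS.H₂ i = (p.μ i).map uToM := rfl

theorem mass_uToM (z : UPos d) : ((uToM z).1.mass : ℝ) = ∑ i, z.1 i := mass_ofVec z.2.1

theorem pairing_uToM (z : UPos d) (f : Fin d → ℝ) :
    pairing (uToM z).1 f = ∑ i, z.1 i * f i := pairing_ofVec z.2.1 f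

theorem min_sq_le {s n M : ℝ} (hn : 0 ≤ n) (hM : 0 ≤ M) (hs : 0 ≤ s) (h : s ≤ M * n) :
    min s (s ^ 2) ≤ (M + M ^ 2) * min n (n ^ 2) := by
  rcases le_total n (n ^ 2) with h1 | h1
  · rw [min_eq_left h1]
    exact (min_le_left _ _).trans (h.trans (by nlinarith [sq_nonneg M]))
  · rw [min_eq_right h1]
    refine (min_le_right _ _).trans ?_
    calc s ^ 2 ≤ (M * n) ^ 2 := pow_le_pow_left₀ hs h 2
      _ ≤ _ := by nlinarith [mul_nonneg hM (sq_nonneg n)]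

theorem IsAdmissible.lintegral_lt_top (hp : p.IsAdmissible) (i : Fin d) (M : ℝ) :
    ∫⁻ z, ENNReal.ofReal (M * min ‖z.1‖ (‖z.1‖ ^ 2)) ∂(p.μ i) < ∞ :=
  ((hp.integrable_min i).const_mul M).lintegral_lt_top

theorem IsAdmissible.lintegral_min_mass_lt_top (hp : p.IsAdmissible) (i : Fin d) :
    ∫⁻ κ, ((min κ.1.mass (κ.1.mass ^ 2) : ℝ≥0) : ℝ≥0∞) ∂(p.toIS.H₂ i) < ∞ := by
  refine (lintegral_map_le _ _).trans_lt (lt_of_le_of_lt (lintegral_mono fun z => ?_)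
    (hp.lintegral_lt_top i (d + d ^ 2)))
  rw [← ENNReal.ofReal_coe_nnreal]
  refine ENNReal.ofReal_le_ofReal ?_
  push_cast
  rw [mass_uToM]
  exact min_sq_le (norm_nonneg _) (Nat.cast_nonneg d)
    (Finset.sum_nonneg fun j _ => z.2.1 j) (sum_coord_le _)

theorem IsAdmissible.toIS_isAdmissible (hp : p.IsAdmissible) (hmom : p.MomentCondition) :
    p.toIS.IsAdmissible where
  metrizable := inferInstance
  separable := inferInstance
  locally_compact := inferInstance
  borel := inferInstance
  semigroup := by
    refine ⟨fun t => ?_, rfl, fun s t => (Kernel.id_comp _).symm⟩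
    change IsMarkovKernel Kernel.id
    infer_instance
  hunt := exists_huntProcess_id d
  feller f := ⟨fun _ => f, continuous_const, fun t x => by
    change f x = ∫ y, f y ∂(Kernel.id x)
    rw [Kernel.id_apply, integral_dirac]⟩
  c_continuous := continuous_of_discreteTopology
  c_nonneg := hp.c_nonneg
  c_bounded := ⟨∑ i, |p.c i|, fun x =>
    Finset.single_le_sum (f := fun i => |p.c i|) (fun i _ => abs_nonneg _) (Finset.mem_univ x)⟩
  b_continuous := continuous_of_discreteTopology
  b_bounded := ⟨∑ i, |p.toIS.b i|, fun x =>
    Finset.single_le_sum (f := fun i => |p.toIS.b i|) (fun i _ => abs_nonneg _)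
      (Finset.mem_univ x)⟩
  H₁_moment := by
    refine (lintegral_map_le _ _).trans_lt (lt_of_le_of_lt (lintegral_mono fun z => ?_)
      ((hp.integrable_norm hmom).const_mul (d : ℝ)).lintegral_lt_top)
    rw [← ENNReal.ofReal_coe_nnreal, mass_uToM]
    exact ENNReal.ofReal_le_ofReal (sum_coord_le _)
  B_bounded := ⟨∑ i, (ofVec fun j => if j = i then 0 else p.B j i).mass, fun x => by
    change (ofVec fun j => if j = x then 0 else p.B j x : Measure (Fin d)) univ ≤ _
    rw [← FiniteMeasure.ennreal_mass, ENNReal.coe_le_coe]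
    exact Finset.single_le_sum
      (f := fun i => (ofVec fun j => if j = i then 0 else p.B j i).mass)
      (fun i _ => zero_le) (Finset.mem_univ x)⟩
  H₂_sigmaFinite i := by
    -- a measure that integrates a positive function is σ-finite
    set g : MPos (Fin d) → ℝ≥0∞ := fun κ => ((min κ.1.mass (κ.1.mass ^ 2) : ℝ≥0) : ℝ≥0∞)
    have hg : Measurable g := by
      have h : Measurable fun κ : MPos (Fin d) => κ.1.mass := by
        simpa [Function.comp_def] using
          (measurable_mass_fin.comp (measurable_subtype_coe (p := (· ≠ 0)))).real_toNNReal
      exact (h.min (h.pow_const 2)).coe_nnreal_ennreal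
    have h0 : ∀ κ, g κ ≠ 0 := fun κ => by
      have h1 : 0 < κ.1.mass :=
        pos_iff_ne_zero.2 ((FiniteMeasure.mass_nonzero_iff _).2 κ.2)
      exact ENNReal.coe_ne_zero.2 (lt_min h1 (pow_pos h1 2)).ne'
    have : IsFiniteMeasure ((p.toIS.H₂ i).withDensity g) :=
      isFiniteMeasure_withDensity (hp.lintegral_min_mass_lt_top i).ne
    rw [← withDensity_inv_same (μ := p.toIS.H₂ i) hg (ae_of_all _ h0)
      (ae_of_all _ fun κ => ENNReal.coe_ne_top)]
    exact SigmaFinite.withDensity_of_ne_top (ae_of_all _ fun κ => ENNReal.inv_ne_top.2 (h0 κ))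
  H₂_finite := hp.lintegral_min_mass_lt_top
  H₂_continuous g := continuous_of_discreteTopology
  H₂_preserves f hf := by
    refine ⟨⟨⟨fun x => (∫⁻ κ, ENNReal.ofReal (min (pairing κ.1 f) (pairing κ.1 f ^ 2))
      ∂(p.toIS.H₂ x)).toReal, continuous_of_discreteTopology⟩, by simp⟩,
      fun x => ⟨ENNReal.toReal_nonneg, (ENNReal.ofReal_toReal (ne_of_lt ?_)).symm⟩⟩
    have hb : ∀ i, f i ≤ ‖f.toBCF‖ := fun i =>
      (le_abs_self _).trans (f.toBCF.norm_coe_le_norm i)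
    refine (lintegral_map_le _ _).trans_lt (lt_of_le_of_lt (lintegral_mono fun z => ?_)
      (hp.lintegral_lt_top x (d * ‖f.toBCF‖ + (d * ‖f.toBCF‖) ^ 2)))
    refine ENNReal.ofReal_le_ofReal ?_
    rw [pairing_uToM]
    refine min_sq_le (norm_nonneg _) (by positivity)
      (Finset.sum_nonneg fun j _ => mul_nonneg (z.2.1 j) (hf j)) ?_
    calc ∑ i, z.1 i * f i ≤ ∑ i, z.1 i * ‖f.toBCF‖ :=
          Finset.sum_le_sum fun i _ => mul_le_mul_of_nonneg_left (hb i) (z.2.1 i)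
      _ = (∑ i, z.1 i) * ‖f.toBCF‖ := by rw [Finset.sum_mul]
      _ ≤ (d * ‖z.1‖) * ‖f.toBCF‖ :=
          mul_le_mul_of_nonneg_right (sum_coord_le _) (norm_nonneg _)
      _ = _ := by ring
  gamma_preserves f hf := by
    refine ⟨⟨⟨fun x => (p.toIS.gamma x f).toReal, continuous_of_discreteTopology⟩, by simp⟩,
      fun x => ⟨ENNReal.toReal_nonneg, (ENNReal.ofReal_toReal (ne_of_lt ?_)).symm⟩⟩
    have hb : ∀ i, f i ≤ ‖f.toBCF‖ := fun i =>
      (le_abs_self _).trans (f.toBCF.norm_coe_le_norm i)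
    refine ENNReal.add_lt_top.2 ⟨?_, ?_⟩
    · change ∫⁻ y, ENNReal.ofReal (f y)
        ∂(ofVec fun j => if j = x then 0 else p.B j x : Measure (Fin d)) < ∞
      refine lt_of_le_of_lt (lintegral_mono fun y => ENNReal.ofReal_le_ofReal (hb y)) ?_
      rw [lintegral_const]
      exact ENNReal.mul_lt_top ENNReal.ofReal_lt_top (measure_lt_top _ _)
    · have hi : Integrable (fun z : UPos d => ∑ j ∈ Finset.univ.erase x, z.1 j) (p.μ x) :=
        integrable_finsetSum _ fun j hj => hp.integrable_coord (Finset.ne_of_mem_erase hj)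
      refine (lintegral_map_le _ _).trans_lt (lt_of_le_of_lt (lintegral_mono fun z => ?_)
        (hi.const_mul ‖f.toBCF‖).lintegral_lt_top)
      refine (lintegral_mono fun y => ENNReal.ofReal_le_ofReal (hb y)).trans ?_
      rw [lintegral_const, Measure.restrict_apply_univ, ENNReal.ofReal_mul (norm_nonneg _),
        ENNReal.ofReal_sum_of_nonneg fun j _ => z.2.1 j]
      refine mul_le_mul_right ?_ _
      change (ofVec fun i => z.1 i : Measure (Fin d)) {x}ᶜ ≤ _
      rw [ofVec_toMeasure_apply, ← Finset.add_sum_erase _ _ (Finset.mem_univ x)]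
      simp only [mem_compl_iff, mem_singleton_iff, not_true_eq_false, not_false_eq_true,
        indicator_of_notMem, mul_zero, zero_add]
      refine Finset.sum_le_sum fun j _ => ?_
      refine (mul_le_mul_right (indicator_le_self _ _ _) _).trans_eq ?_
      simp [ENNReal.ofReal]

end CBIParams
/-! ### Bounded `C²` functions on the orthant and the Lévy integrals -/

/-- Bounded functions that are twice continuously differentiable up to the boundary of the
orthant. This class contains `C²_c` and the exponentials, and the generator is given on it by
absolutely convergent integrals. -/
structure IsC2b {d : ℕ} (f : EuclideanSpace ℝ (Fin d) → ℝ) : Prop where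
  smooth : ContDiffOn ℝ 2 f (orthant d)
  bounded : ∃ M, ∀ x ∈ orthant d, |f x| ≤ M

theorem IsC2c.isC2b {d : ℕ} {f : EuclideanSpace ℝ (Fin d) → ℝ} (hf : IsC2c f) : IsC2b f := by
  refine ⟨hf.smooth, ?_⟩
  obtain ⟨K, hK, h0⟩ := hf.support
  obtain ⟨M, hM⟩ := (hK.inter_left (isClosed_orthant d)).exists_bound_of_continuousOn
    (hf.smooth.continuousOn.mono inter_subset_left)
  refine ⟨max M 0, fun x hx => ?_⟩
  by_cases h : x ∈ K
  · exact (hM x ⟨hx, h⟩).trans (le_max_left _ _)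
  · rw [h0 x hx h, abs_zero]
    exact le_max_right _ _

theorem fderivWithin_orthant_apply {d : ℕ} (f : EuclideanSpace ℝ (Fin d) → ℝ)
    (x z : EuclideanSpace ℝ (Fin d)) :
    fderivWithin ℝ f (orthant d) x z = ∑ j, z j * pd f j x := by
  have h : z = ∑ j, z j • EuclideanSpace.single j (1 : ℝ) := by
    ext i
    simp [Finset.sum_apply, Pi.single_apply]
  conv_lhs => rw [h]
  simp only [map_sum, map_smul, smul_eq_mul]
  rfl

namespace IsC2b

variable {d : ℕ} {f : EuclideanSpace ℝ (Fin d) → ℝ}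

theorem hasFDerivWithinAt (hf : IsC2b f) {x : EuclideanSpace ℝ (Fin d)} (hx : x ∈ orthant d) :
    HasFDerivWithinAt f (fderivWithin ℝ f (orthant d) x) (orthant d) x :=
  (hf.smooth.differentiableOn (by norm_num) x hx).hasFDerivWithinAt

theorem contDiffOn_fderivWithin (hf : IsC2b f) :
    ContDiffOn ℝ 1 (fderivWithin ℝ f (orthant d)) (orthant d) :=
  hf.smooth.fderivWithin (uniqueDiffOn_orthant d) (by norm_num)

theorem contDiffOn_pd (hf : IsC2b f) (i : Fin d) : ContDiffOn ℝ 1 (pd f i) (orthant d) :=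
  hf.contDiffOn_fderivWithin.clm_apply contDiffOn_const

theorem continuousOn_pd_pd (hf : IsC2b f) (i : Fin d) :
    ContinuousOn (pd (pd f i) i) (orthant d) :=
  ((hf.contDiffOn_pd i).continuousOn_fderivWithin (uniqueDiffOn_orthant d) (by norm_num)).clm_apply
    continuousOn_const

/-- First and second order Taylor estimates, uniform over bounded parts of the orthant. -/
theorem exists_taylor_bound (hf : IsC2b f) (R : ℝ) : ∃ C, 0 ≤ C ∧ ∀ x ∈ orthant d, ‖x‖ ≤ R →
    (∀ i, |pd f i x| ≤ C) ∧ ∀ z ∈ orthant d,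
      |f (x + z) - f x| ≤ C * min 1 ‖z‖ ∧
      |f (x + z) - f x - ∑ j, z j * pd f j x| ≤ C * min ‖z‖ (‖z‖ ^ 2) := by
  obtain ⟨M, hM⟩ := hf.bounded
  set F := fderivWithin ℝ f (orthant d) with hF
  set K := orthant d ∩ Metric.closedBall 0 (R + 1) with hKdef
  have hK : IsCompact K := (isCompact_closedBall _ _).inter_left (isClosed_orthant d)
  have hKc : Convex ℝ K := (convex_orthant d).inter (convex_closedBall _ _)
  have hFc := hf.contDiffOn_fderivWithin
  obtain ⟨A, hA⟩ := hK.exists_bound_of_continuousOn (hFc.continuousOn.mono inter_subset_left)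
  obtain ⟨L, hL⟩ := hK.exists_bound_of_continuousOn
    ((hFc.continuousOn_fderivWithin (uniqueDiffOn_orthant d) (by norm_num)).mono
      (inter_subset_left (t := Metric.closedBall 0 (R + 1))))
  refine ⟨2 * |M| + |A| + |L|, by positivity, fun x hx hxR => ?_⟩
  have hxK : x ∈ K := ⟨hx, by simpa using by linarith⟩
  have hFx : ‖F x‖ ≤ |A| := (hA x hxK).trans (le_abs_self _)
  have hM0 : 0 ≤ |M| := abs_nonneg _
  have hA0 : 0 ≤ |A| := abs_nonneg _
  have hL0 : 0 ≤ |L| := abs_nonneg _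
  refine ⟨fun i => ?_, fun z hz => ?_⟩
  · have : |pd f i x| ≤ ‖F x‖ * ‖EuclideanSpace.single i (1 : ℝ)‖ := (F x).le_opNorm _
    rw [PiLp.norm_single, norm_one, mul_one] at this
    linarith
  have hxz := add_mem_orthant hx hz
  have h2M : |f (x + z) - f x| ≤ 2 * |M| := by
    have h1 := (hM _ hxz).trans (le_abs_self M)
    have h2 := (hM _ hx).trans (le_abs_self M)
    exact (abs_sub _ _).trans (by linarith)
  have hFz : |F x z| ≤ |A| * ‖z‖ :=
    ((F x).le_opNorm z).trans (mul_le_mul_of_nonneg_right hFx (norm_nonneg _))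
  rw [← fderivWithin_orthant_apply, ← hF]
  rcases le_total ‖z‖ 1 with h1 | h1
  · have hsq : ‖z‖ ^ 2 ≤ ‖z‖ := by nlinarith [norm_nonneg z]
    rw [min_eq_right h1, min_eq_right hsq]
    set K' := orthant d ∩ Metric.closedBall x ‖z‖
    have hK'c : Convex ℝ K' := (convex_orthant d).inter (convex_closedBall _ _)
    have hK' : K' ⊆ K := fun y hy => ⟨hy.1, by
      have := hy.2
      rw [mem_closedBall_iff_norm] at this
      rw [mem_closedBall_zero_iff]
      have := norm_le_norm_add_norm_sub x y
      rw [norm_sub_rev] at this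
      linarith⟩
    have hx' : x ∈ K' := ⟨hx, by simp⟩
    have hxz' : x + z ∈ K' := ⟨hxz, by simp⟩
    have hder : ∀ y ∈ K', HasFDerivWithinAt f (F y) K' y := fun y hy =>
      (hf.hasFDerivWithinAt hy.1).mono inter_subset_left
    have hLip : ∀ y ∈ K', ‖F y - F x‖ ≤ |L| * ‖z‖ := fun y hy => by
      have := hKc.norm_image_sub_le_of_norm_hasFDerivWithin_le (f := F)
        (fun w hw => ((hFc.differentiableOn (by norm_num) w hw.1).hasFDerivWithinAt).mono
          inter_subset_left) (fun w hw => (hL w hw).trans (le_abs_self L)) hxK (hK' hy)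
      exact this.trans (mul_le_mul_of_nonneg_left (mem_closedBall_iff_norm.1 hy.2) hL0)
    constructor
    · have := hK'c.norm_image_sub_le_of_norm_hasFDerivWithin_le hder
        (fun w hw => (hA w (hK' hw)).trans (le_abs_self A)) hx' hxz'
      rw [add_sub_cancel_left, Real.norm_eq_abs] at this
      nlinarith [norm_nonneg z]
    · have := hK'c.norm_image_sub_le_of_norm_hasFDerivWithin_le' hder hLip hx' hxz'
      rw [add_sub_cancel_left, Real.norm_eq_abs] at this
      nlinarith [norm_nonneg z, sq_nonneg ‖z‖]
  · have hsq : ‖z‖ ≤ ‖z‖ ^ 2 := by nlinarith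
    rw [min_eq_left h1, min_eq_left hsq]
    constructor
    · linarith
    · refine (abs_sub _ _).trans ?_
      nlinarith

theorem measurable_shift (hf : IsC2b f) {x : EuclideanSpace ℝ (Fin d)} (hx : x ∈ orthant d) :
    Measurable fun z : UPos d => f (x + z.1) :=
  (hf.smooth.continuousOn.comp_continuous (by fun_prop)
    fun z => add_mem_orthant hx z.2.1).measurable

variable {p : CBIParams d}

theorem integrable_immigration (hf : IsC2b f) (hp : p.IsAdmissible)
    {x : EuclideanSpace ℝ (Fin d)} (hx : x ∈ orthant d) :
    Integrable (fun z : UPos d => f (x + z.1) - f x) p.ν := by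
  obtain ⟨C, _, h⟩ := hf.exists_taylor_bound ‖x‖
  exact (hp.integrable_min_one.const_mul C).mono'
    ((hf.measurable_shift hx).sub_const _).aestronglyMeasurable
    (ae_of_all _ fun z => ((h x hx le_rfl).2 z.1 z.2.1).1)

theorem integrable_taylor (hf : IsC2b f) (hp : p.IsAdmissible)
    {x : EuclideanSpace ℝ (Fin d)} (hx : x ∈ orthant d) (i : Fin d) :
    Integrable (fun z : UPos d => f (x + z.1) - f x - ∑ j, z.1 j * pd f j x) (p.μ i) := by
  obtain ⟨C, _, h⟩ := hf.exists_taylor_bound ‖x‖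
  exact ((hp.integrable_min i).const_mul C).mono'
    (((hf.measurable_shift hx).sub_const _).sub (by fun_prop)).aestronglyMeasurable
    (ae_of_all _ fun z => ((h x hx le_rfl).2 z.1 z.2.1).2)

/-- The truncation `1 ∧ z_i` and the full first order Taylor term differ by the functions whose
integrals define `B̃ - B`. -/
theorem branching_eq_taylor_add (f : EuclideanSpace ℝ (Fin d) → ℝ)
    (x : EuclideanSpace ℝ (Fin d)) (i : Fin d) (z : UPos d) :
    f (x + z.1) - f x - pd f i x * min 1 (z.1 i)
      = (f (x + z.1) - f x - ∑ j, z.1 j * pd f j x)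
        + ∑ j, pd f j x * max (z.1 j - if j = i then 1 else 0) 0 := by
  have h : ∀ j, z.1 j * pd f j x = pd f j x * max (z.1 j - if j = i then 1 else 0) 0
      + if j = i then pd f i x * min 1 (z.1 i) else 0 := fun j => by
    by_cases hj : j = i
    · subst hj
      simp only [if_true]
      have : max (z.1 j - 1) 0 + min 1 (z.1 j) = z.1 j := by
        rcases le_total (z.1 j) 1 with h | h
        · rw [max_eq_right (by linarith), min_eq_right h, zero_add]
        · rw [max_eq_left (by linarith), min_eq_left h, sub_add_cancel]
      rw [← mul_add, this, mul_comm]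
    · simp only [hj, if_false, sub_zero, add_zero]
      rw [max_eq_left (z.2.1 j), mul_comm]
  rw [Finset.sum_congr rfl fun j _ => h j, Finset.sum_add_distrib]
  simp only [Finset.sum_ite_eq', Finset.mem_univ, if_true]
  ring

theorem integrable_branching (hf : IsC2b f) (hp : p.IsAdmissible)
    {x : EuclideanSpace ℝ (Fin d)} (hx : x ∈ orthant d) (i : Fin d) :
    Integrable (fun z : UPos d => f (x + z.1) - f x - pd f i x * min 1 (z.1 i)) (p.μ i) := by
  simp only [branching_eq_taylor_add]
  exact (hf.integrable_taylor hp hx i).add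
    (integrable_finsetSum _ fun j _ => (hp.integrable_max j i).const_mul _)

theorem integral_branching (hf : IsC2b f) (hp : p.IsAdmissible)
    {x : EuclideanSpace ℝ (Fin d)} (hx : x ∈ orthant d) (i : Fin d) :
    ∫ z : UPos d, (f (x + z.1) - f x - pd f i x * min 1 (z.1 i)) ∂(p.μ i)
      = (∫ z : UPos d, (f (x + z.1) - f x - ∑ j, z.1 j * pd f j x) ∂(p.μ i))
        + ∑ j, pd f j x * (p.Btilde j i - p.B j i) := by
  simp only [branching_eq_taylor_add]
  rw [integral_add (hf.integrable_taylor hp hx i)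
    (integrable_finsetSum _ fun j _ => (hp.integrable_max j i).const_mul _),
    integral_finsetSum _ fun j _ => (hp.integrable_max j i).const_mul _]
  congr 1
  refine Finset.sum_congr rfl fun j _ => ?_
  rw [integral_const_mul, CBIParams.Btilde, add_sub_cancel_left]

theorem gen_eq_genAlt (hf : IsC2b f) (hp : p.IsAdmissible)
    {x : EuclideanSpace ℝ (Fin d)} (hx : x ∈ orthant d) : p.gen f x = p.genAlt f x := by
  have h : ∑ i, x i * ∑ j, pd f j x * (p.Btilde j i - p.B j i)
      = ∑ i, (∑ j, p.Btilde i j * x j) * pd f i x - ∑ i, (∑ j, p.B i j * x j) * pd f i x := by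
    simp only [Finset.mul_sum, Finset.sum_mul]
    rw [Finset.sum_comm, ← Finset.sum_sub_distrib]
    refine Finset.sum_congr rfl fun i _ => ?_
    rw [← Finset.sum_sub_distrib]
    exact Finset.sum_congr rfl fun j _ => by ring
  simp only [CBIParams.gen, CBIParams.genAlt, hf.integral_branching hp hx, mul_add, add_mul,
    Finset.sum_add_distrib, h]
  ring

/-- The generator of a bounded `C²` function is continuous. -/
theorem continuousOn_gen (hf : IsC2b f) (hp : p.IsAdmissible) :
    ContinuousOn (p.gen f) (orthant d) := by
  have hpd : ∀ i, ContinuousOn (pd f i) (orthant d) := fun i => (hf.contDiffOn_pd i).continuousOn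
  have hc : ∀ i, Continuous fun x : EuclideanSpace ℝ (Fin d) => x i := fun i => by fun_prop
  have hfc : ∀ z : UPos d, ContinuousOn (fun x => f (x + z.1)) (orthant d) := fun z =>
    hf.smooth.continuousOn.comp (by fun_prop) fun x hx => add_mem_orthant hx z.2.1
  have hnear : ∀ x : EuclideanSpace ℝ (Fin d),
      ∀ᶠ y in 𝓝[orthant d] x, y ∈ orthant d ∧ ‖y‖ ≤ ‖x‖ + 1 := fun x =>
    eventually_mem_nhdsWithin.and (mem_nhdsWithin_of_mem_nhds
      ((continuous_norm.tendsto x).eventually_le_const (lt_add_one _)))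
  refine ((ContinuousOn.add ?_ ?_).add ?_).add ?_
  · exact continuousOn_finsetSum _ fun i _ =>
      (continuous_const.mul (hc i)).continuousOn.mul (hf.continuousOn_pd_pd i)
  · refine continuousOn_finsetSum _ fun i _ => ContinuousOn.mul (Continuous.continuousOn ?_) (hpd i)
    exact continuous_const.add (continuous_finsetSum _ fun j _ => continuous_const.mul (hc j))
  · intro x hx
    obtain ⟨C, hC, h⟩ := hf.exists_taylor_bound (‖x‖ + 1)
    refine continuousWithinAt_of_dominated (bound := fun z => C * min 1 ‖z.1‖) ?_ ?_
      (hp.integrable_min_one.const_mul C) (ae_of_all _ fun z => ?_)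
    · filter_upwards [hnear x] with y hy
      exact ((hf.measurable_shift hy.1).sub_const _).aestronglyMeasurable
    · filter_upwards [hnear x] with y hy
      exact ae_of_all _ fun z => ((h y hy.1 hy.2).2 z.1 z.2.1).1
    · exact (hfc z x hx).sub (hf.smooth.continuousOn x hx)
  · refine continuousOn_finsetSum _ fun i _ => (hc i).continuousOn.mul fun x hx => ?_
    obtain ⟨C, hC, h⟩ := hf.exists_taylor_bound (‖x‖ + 1)
    refine continuousWithinAt_of_dominated (bound := fun z => C * min ‖z.1‖ (‖z.1‖ ^ 2)
      + ∑ j, C * max (z.1 j - if j = i then 1 else 0) 0) ?_ ?_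
      (((hp.integrable_min i).const_mul C).add
        (integrable_finsetSum _ fun j _ => (hp.integrable_max j i).const_mul _))
      (ae_of_all _ fun z => ?_)
    · filter_upwards [hnear x] with y hy
      exact (((hf.measurable_shift hy.1).sub_const _).sub (by fun_prop)).aestronglyMeasurable
    · filter_upwards [hnear x] with y hy
      refine ae_of_all _ fun z => ?_
      rw [branching_eq_taylor_add]
      refine (norm_add_le _ _).trans (add_le_add ((h y hy.1 hy.2).2 z.1 z.2.1).2 ?_)
      refine (norm_sum_le _ _).trans (Finset.sum_le_sum fun j _ => ?_)
      rw [norm_mul, Real.norm_of_nonneg (le_max_right _ (0 : ℝ))]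
      exact mul_le_mul_of_nonneg_right ((h y hy.1 hy.2).1 j) (le_max_right _ _)
    · exact ((hfc z x hx).sub (hf.smooth.continuousOn x hx)).sub
        ((hpd i x hx).mul continuousWithinAt_const)

end IsC2b
/-! ### Linearity of the generator and the positive maximum principle -/

theorem pd_congr {d : ℕ} {f g : EuclideanSpace ℝ (Fin d) → ℝ} (h : EqOn f g (orthant d))
    (i : Fin d) {x : EuclideanSpace ℝ (Fin d)} (hx : x ∈ orthant d) : pd f i x = pd g i x := by
  rw [pd, pd, fderivWithin_congr h (h hx)]

theorem pd_linComb {d : ℕ} {f g : EuclideanSpace ℝ (Fin d) → ℝ} (a b : ℝ) (i : Fin d)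
    {x : EuclideanSpace ℝ (Fin d)} (hx : x ∈ orthant d)
    (hf : DifferentiableWithinAt ℝ f (orthant d) x)
    (hg : DifferentiableWithinAt ℝ g (orthant d) x) :
    pd (fun y => a * f y + b * g y) i x = a * pd f i x + b * pd g i x := by
  have h := ((hf.hasFDerivWithinAt.const_mul a).add (hg.hasFDerivWithinAt.const_mul b)).fderivWithin
    (uniqueDiffOn_orthant d x hx)
  have h' : fderivWithin ℝ (fun y => a * f y + b * g y) (orthant d) x = _ := h
  rw [pd, h']
  rfl

namespace IsC2b

variable {d : ℕ} {p : CBIParams d} {f g : EuclideanSpace ℝ (Fin d) → ℝ}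

theorem linComb (hf : IsC2b f) (hg : IsC2b g) (a b : ℝ) :
    IsC2b fun x => a * f x + b * g x := by
  obtain ⟨M, hM⟩ := hf.bounded
  obtain ⟨N, hN⟩ := hg.bounded
  refine ⟨(contDiffOn_const.mul hf.smooth).add (contDiffOn_const.mul hg.smooth),
    |a| * M + |b| * N, fun x hx => (abs_add_le _ _).trans ?_⟩
  rw [abs_mul, abs_mul]
  exact add_le_add (mul_le_mul_of_nonneg_left (hM x hx) (abs_nonneg _))
    (mul_le_mul_of_nonneg_left (hN x hx) (abs_nonneg _))

theorem gen_linComb (hf : IsC2b f) (hg : IsC2b g) (hp : p.IsAdmissible) (a b : ℝ)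
    {x : EuclideanSpace ℝ (Fin d)} (hx : x ∈ orthant d) :
    p.gen (fun y => a * f y + b * g y) x = a * p.gen f x + b * p.gen g x := by
  have h1 : ∀ i, EqOn (pd (fun y => a * f y + b * g y) i) (fun y => a * pd f i y + b * pd g i y)
      (orthant d) := fun i y hy =>
    pd_linComb a b i hy (hf.hasFDerivWithinAt hy).differentiableWithinAt
      (hg.hasFDerivWithinAt hy).differentiableWithinAt
  have h2 : ∀ i, pd (pd (fun y => a * f y + b * g y) i) i x
      = a * pd (pd f i) i x + b * pd (pd g i) i x := fun i => by
    rw [pd_congr (h1 i) i hx]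
    exact pd_linComb a b i hx ((hf.contDiffOn_pd i).differentiableOn (by norm_num) x hx)
      ((hg.contDiffOn_pd i).differentiableOn (by norm_num) x hx)
  have h3 : ∫ z : UPos d, (a * f (x + z.1) + b * g (x + z.1) - (a * f x + b * g x)) ∂p.ν
      = a * ∫ z : UPos d, (f (x + z.1) - f x) ∂p.ν
        + b * ∫ z : UPos d, (g (x + z.1) - g x) ∂p.ν := by
    rw [← integral_const_mul, ← integral_const_mul, ← integral_add
      ((hf.integrable_immigration hp hx).const_mul a)
      ((hg.integrable_immigration hp hx).const_mul b)]
    exact integral_congr_ae (ae_of_all _ fun z => by ring)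
  have h4 : ∀ i, ∫ z : UPos d, (a * f (x + z.1) + b * g (x + z.1) - (a * f x + b * g x)
        - (a * pd f i x + b * pd g i x) * min 1 (z.1 i)) ∂(p.μ i)
      = a * ∫ z : UPos d, (f (x + z.1) - f x - pd f i x * min 1 (z.1 i)) ∂(p.μ i)
        + b * ∫ z : UPos d, (g (x + z.1) - g x - pd g i x * min 1 (z.1 i)) ∂(p.μ i) := fun i => by
    rw [← integral_const_mul, ← integral_const_mul, ← integral_add
      ((hf.integrable_branching hp hx i).const_mul a)
      ((hg.integrable_branching hp hx i).const_mul b)]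
    exact integral_congr_ae (ae_of_all _ fun z => by ring)
  simp only [CBIParams.gen, h2, h1 _ hx, h3, h4]
  simp only [mul_add, Finset.sum_add_distrib, Finset.mul_sum]
  have e1 : ∀ c : ℝ, ∀ F : Fin d → ℝ, ∀ w : Fin d → ℝ,
      ∑ i, w i * (c * F i) = ∑ i, c * (w i * F i) := fun c F w =>
    Finset.sum_congr rfl fun i _ => by ring
  simp only [e1]
  ring

/-- The directions `e_i` point into the orthant, so a maximum makes the partial derivatives
nonpositive; on the face `x_i = 0` they need not vanish. -/
theorem pd_nonpos_of_isMaxOn (hf : IsC2b f) {x : EuclideanSpace ℝ (Fin d)} (hx : x ∈ orthant d)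
    (hmax : IsMaxOn f (orthant d) x) (i : Fin d) : pd f i x ≤ 0 := by
  refine (hmax.localize).hasFDerivWithinAt_nonpos (hf.hasFDerivWithinAt hx)
    (mem_posTangentConeAt_of_segment_subset ((convex_orthant d).segment_subset hx ?_))
  refine add_mem_orthant hx fun j => ?_
  by_cases h : j = i <;> simp [h]

theorem pd_eq_zero_of_isMaxOn (hf : IsC2b f) {x : EuclideanSpace ℝ (Fin d)} (hx : x ∈ orthant d)
    (hmax : IsMaxOn f (orthant d) x) {i : Fin d} (hi : 0 < x i) : pd f i x = 0 := by
  refine le_antisymm (hf.pd_nonpos_of_isMaxOn hx hmax i) ?_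
  have h := (hmax.localize).hasFDerivWithinAt_nonpos (hf.hasFDerivWithinAt hx)
    (y := (-x i) • EuclideanSpace.single i (1 : ℝ))
    (mem_posTangentConeAt_of_segment_subset ((convex_orthant d).segment_subset hx ?_))
  · rw [map_smul, smul_eq_mul] at h
    change -x i * pd f i x ≤ 0 at h
    nlinarith
  · intro j
    by_cases h : j = i
    · subst h; simp
    · simpa [h] using hx j

theorem hasDerivAt_line {h : EuclideanSpace ℝ (Fin d) → ℝ} {x : EuclideanSpace ℝ (Fin d)}
    (hx : x ∈ orthant d) (i : Fin d) {s : ℝ} (hs : -x i < s)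
    (hh : DifferentiableWithinAt ℝ h (orthant d) (x + s • EuclideanSpace.single i 1)) :
    HasDerivAt (fun s : ℝ => h (x + s • EuclideanSpace.single i 1))
      (pd h i (x + s • EuclideanSpace.single i 1)) s := by
  have h1 : HasDerivAt (fun s : ℝ => x + s • EuclideanSpace.single i (1 : ℝ))
      (EuclideanSpace.single i 1) s := by
    simpa using ((hasDerivAt_id s).smul_const (EuclideanSpace.single i (1 : ℝ))).const_add x
  refine HasFDerivWithinAt.comp_hasDerivAt s hh.hasFDerivWithinAt h1 ?_
  filter_upwards [lt_mem_nhds hs] with t ht j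
  by_cases hj : j = i
  · subst hj
    simp; linarith
  · simpa [hj] using hx j

theorem pd_pd_nonpos_of_isMaxOn (hf : IsC2b f) {x : EuclideanSpace ℝ (Fin d)}
    (hx : x ∈ orthant d) (hmax : IsMaxOn f (orthant d) x) {i : Fin d} (hi : 0 < x i) :
    pd (pd f i) i x ≤ 0 := by
  set l : ℝ → EuclideanSpace ℝ (Fin d) := fun s => x + s • EuclideanSpace.single i 1 with hl
  have hl0 : l 0 = x := by simp [hl]
  have hmem : ∀ s, -x i < s → l s ∈ orthant d := fun s hs j => by
    by_cases hj : j = i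
    · subst hj
      simp [hl]; linarith
    · simpa [hl, hj] using hx j
  have hnear : ∀ᶠ s in 𝓝 (0 : ℝ), -x i < s := lt_mem_nhds (by linarith)
  have hd : ∀ s, -x i < s → HasDerivAt (fun s => f (l s)) (pd f i (l s)) s := fun s hs =>
    hasDerivAt_line hx i hs (hf.hasFDerivWithinAt (hmem s hs)).differentiableWithinAt
  have hdd : deriv (deriv fun s => f (l s)) 0 = pd (pd f i) i x := by
    have h1 : deriv (fun s => f (l s)) =ᶠ[𝓝 0] fun s => pd f i (l s) := by
      filter_upwards [hnear] with s hs using (hd s hs).deriv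
    rw [h1.deriv_eq, ← hl0]
    have h2 := hasDerivAt_line hx i (s := 0) (by linarith)
      ((hf.contDiffOn_pd i).differentiableOn (by norm_num) _ (hmem 0 (by linarith)))
    exact h2.deriv
  have hd0 : deriv (fun s => f (l s)) 0 = 0 := by
    rw [(hd 0 (by linarith)).deriv, hl0, hf.pd_eq_zero_of_isMaxOn hx hmax hi]
  by_contra hpos
  rw [not_le, ← hdd] at hpos
  -- a strictly positive second derivative would make the maximum a local minimum as well
  have hmin := isLocalMin_of_deriv_deriv_pos hpos hd0 (hd 0 (by linarith)).continuousAt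
  have hconst : (fun s => f (l s)) =ᶠ[𝓝 0] fun _ => f x := by
    filter_upwards [hmin, hnear] with s h1 h2
    exact le_antisymm (hmax (hmem s h2)) (by simpa [hl0] using h1)
  have hz : deriv (fun s => f (l s)) =ᶠ[𝓝 0] fun _ => 0 := by
    filter_upwards [hconst.eventuallyEq_nhds] with s hs
    rw [hs.deriv_eq, deriv_const]
  rw [hz.deriv_eq, deriv_const] at hpos
  exact lt_irrefl _ hpos

theorem gen_nonpos_of_isMaxOn (hf : IsC2b f) (hp : p.IsAdmissible)
    {x : EuclideanSpace ℝ (Fin d)} (hx : x ∈ orthant d) (hmax : IsMaxOn f (orthant d) x) :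
    p.gen f x ≤ 0 := by
  have hjump : ∀ z : UPos d, f (x + z.1) - f x ≤ 0 := fun z =>
    sub_nonpos.2 (hmax (add_mem_orthant hx z.2.1))
  have h1 : ∀ i, p.c i * x i * pd (pd f i) i x ≤ 0 := fun i => by
    rcases (hx i).eq_or_lt with h | h
    · rw [← h]; simp
    · exact mul_nonpos_of_nonneg_of_nonpos (mul_nonneg (hp.c_nonneg i) (hx i))
        (hf.pd_pd_nonpos_of_isMaxOn hx hmax h)
  have h2 : ∀ i, (p.β i + ∑ j, p.B i j * x j) * pd f i x ≤ 0 := fun i => by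
    rcases (hx i).eq_or_lt with h | h
    · refine mul_nonpos_of_nonneg_of_nonpos (add_nonneg (hp.β_nonneg i)
        (Finset.sum_nonneg fun j _ => ?_)) (hf.pd_nonpos_of_isMaxOn hx hmax i)
      by_cases hij : i = j
      · subst hij; rw [← h]; simp
      · exact mul_nonneg (hp.B_nonneg i j hij) (hx j)
    · rw [hf.pd_eq_zero_of_isMaxOn hx hmax h, mul_zero]
  have h3 : ∀ i, x i * ∫ z : UPos d, (f (x + z.1) - f x - pd f i x * min 1 (z.1 i)) ∂(p.μ i)
      ≤ 0 := fun i => by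
    rcases (hx i).eq_or_lt with h | h
    · rw [← h, zero_mul]
    · refine mul_nonpos_of_nonneg_of_nonpos (hx i) (integral_nonpos fun z => ?_)
      rw [hf.pd_eq_zero_of_isMaxOn hx hmax h, zero_mul, sub_zero]
      exact hjump z
  have h4 : ∫ z : UPos d, (f (x + z.1) - f x) ∂p.ν ≤ 0 := integral_nonpos hjump
  have s1 := Finset.sum_nonpos fun i (_ : i ∈ Finset.univ) => h1 i
  have s2 := Finset.sum_nonpos fun i (_ : i ∈ Finset.univ) => h2 i
  have s3 := Finset.sum_nonpos fun i (_ : i ∈ Finset.univ) => h3 i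
  rw [CBIParams.gen]
  linarith

/-- Dissipativity, one-sided form. -/
theorem le_of_sub_gen_le (hf : IsC2b f) (hp : p.IsAdmissible)
    (h0 : Tendsto (fun x : Orthant d => f x.1) (cocompact (Orthant d)) (𝓝 0)) {ε : ℝ}
    (hε : 0 ≤ ε) (h : ∀ x ∈ orthant d, f x - p.gen f x ≤ ε) {x : EuclideanSpace ℝ (Fin d)}
    (hx : x ∈ orthant d) : f x ≤ ε := by
  rcases le_or_gt (f x) 0 with hx0 | hx0
  · exact hx0.trans hε
  have hc : Continuous fun x : Orthant d => f x.1 :=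
    hf.smooth.continuousOn.comp_continuous continuous_subtype_val fun x => x.2
  obtain ⟨y, hy⟩ := hc.exists_forall_ge' ⟨x, hx⟩ (h0.eventually_le_const hx0)
  have := hf.gen_nonpos_of_isMaxOn hp y.2 fun z hz => hy ⟨z, hz⟩
  have h1 := h y.1 y.2
  exact (hy ⟨x, hx⟩).trans (by linarith)

/-- Dissipativity of the generator on bounded `C²` functions vanishing at infinity. -/
theorem abs_le_of_abs_sub_gen_le (hf : IsC2b f) (hp : p.IsAdmissible)
    (h0 : Tendsto (fun x : Orthant d => f x.1) (cocompact (Orthant d)) (𝓝 0)) {ε : ℝ}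
    (h : ∀ x ∈ orthant d, |f x - p.gen f x| ≤ ε) {x : EuclideanSpace ℝ (Fin d)}
    (hx : x ∈ orthant d) : |f x| ≤ ε := by
  have hε : 0 ≤ ε := (abs_nonneg _).trans (h x hx)
  have hneg : ∀ y ∈ orthant d, p.gen (fun y => (-1) * f y + 0 * f y) y = -p.gen f y :=
    fun y hy => by rw [hf.gen_linComb hf hp _ _ hy]; ring
  refine abs_le.2 ⟨?_, hf.le_of_sub_gen_le hp h0 hε (fun y hy => (le_abs_self _).trans (h y hy)) hx⟩
  have := (hf.linComb hf (-1) 0).le_of_sub_gen_le hp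
    (by simpa using h0.neg) hε (fun y hy => by
      rw [hneg y hy]
      have := (neg_abs_le (f y - p.gen f y))
      have := h y hy
      linarith) hx
  linarith

end IsC2b

theorem pd_eq_zero_of_eventuallyEq {d : ℕ} {f : EuclideanSpace ℝ (Fin d) → ℝ}
    {x : EuclideanSpace ℝ (Fin d)} (hx : x ∈ orthant d) (h : f =ᶠ[𝓝[orthant d] x] fun _ => 0)
    (i : Fin d) : pd f i x = 0 := by
  rw [pd, h.fderivWithin_eq (h.self_of_nhdsWithin hx)]
  simp

/-- As jumps only increase the coordinates, the generator of a compactly supported function is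
compactly supported. -/
theorem IsC2c.exists_gen_eq_zero {d : ℕ} {f : EuclideanSpace ℝ (Fin d) → ℝ} (hf : IsC2c f)
    (p : CBIParams d) : ∃ R, ∀ x ∈ orthant d, R < ‖x‖ → f x = 0 ∧ p.gen f x = 0 := by
  obtain ⟨K, hK, h0⟩ := hf.support
  obtain ⟨R, hR⟩ := hK.isBounded.exists_norm_le
  have hz : ∀ x ∈ orthant d, R < ‖x‖ → f x = 0 := fun x hx hxR =>
    h0 x hx fun hxK => absurd (hR x hxK) (not_le.2 hxR)
  have hev : ∀ x ∈ orthant d, R < ‖x‖ → ∀ᶠ y in 𝓝[orthant d] x, y ∈ orthant d ∧ R < ‖y‖ :=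
    fun x _ hxR => eventually_mem_nhdsWithin.and (mem_nhdsWithin_of_mem_nhds
      ((continuous_norm.tendsto x).eventually_const_lt hxR))
  have hpd : ∀ i, ∀ x ∈ orthant d, R < ‖x‖ → pd f i x = 0 := fun i x hx hxR =>
    pd_eq_zero_of_eventuallyEq hx ((hev x hx hxR).mono fun y hy => hz y hy.1 hy.2) i
  have hpdd : ∀ i, ∀ x ∈ orthant d, R < ‖x‖ → pd (pd f i) i x = 0 := fun i x hx hxR =>
    pd_eq_zero_of_eventuallyEq hx ((hev x hx hxR).mono fun y hy => hpd i y hy.1 hy.2) i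
  refine ⟨R, fun x hx hxR => ⟨hz x hx hxR, ?_⟩⟩
  have hs : ∀ z : UPos d, f (x + z.1) = 0 := fun z =>
    hz _ (add_mem_orthant hx z.2.1) (hxR.trans_le (norm_le_norm_add hx z.2.1))
  simp [CBIParams.gen, hpd _ x hx hxR, hpdd _ x hx hxR, hs, hz x hx hxR]
/-! ### Exponentials and the branching and immigration mechanisms -/

/-- The exponential `x ↦ e^{-⟨l, x⟩}`. -/
noncomputable def expo {d : ℕ} (l x : EuclideanSpace ℝ (Fin d)) : ℝ := Real.exp (-∑ j, l j * x j)

theorem sum_mul_nonneg {d : ℕ} {l x : EuclideanSpace ℝ (Fin d)} (hl : l ∈ orthant d)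
    (hx : x ∈ orthant d) : 0 ≤ ∑ j, l j * x j :=
  Finset.sum_nonneg fun j _ => mul_nonneg (hl j) (hx j)

theorem sum_mul_le {d : ℕ} {l x : EuclideanSpace ℝ (Fin d)} (hx : x ∈ orthant d) :
    ∑ j, l j * x j ≤ d * ‖l‖ * ‖x‖ := by
  have : ∀ j ∈ Finset.univ, l j * x j ≤ ‖l‖ * ‖x‖ := fun j _ =>
    mul_le_mul (coord_le_norm l j) (coord_le_norm x j) (hx j) (norm_nonneg _)
  simpa [mul_assoc] using Finset.sum_le_card_nsmul _ _ _ this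

theorem exp_neg_sub_one_add_nonneg (a : ℝ) : 0 ≤ Real.exp (-a) - 1 + a := by
  have := Real.add_one_le_exp (-a)
  linarith

theorem exp_neg_sub_one_add_le {a : ℝ} (ha : 0 ≤ a) :
    Real.exp (-a) - 1 + a ≤ min a (a ^ 2) := by
  have h1 : Real.exp (-a) ≤ 1 := Real.exp_le_one_iff.2 (by linarith)
  refine le_min (by linarith) ?_
  rcases le_total a 1 with h | h
  · have := Real.abs_exp_sub_one_sub_id_le (x := -a) (by rwa [abs_neg, abs_of_nonneg ha])
    rw [neg_sq] at this
    linarith [le_abs_self (Real.exp (-a) - 1 - -a)]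
  · nlinarith

section expo

variable {d : ℕ} {p : CBIParams d} {l : EuclideanSpace ℝ (Fin d)}

theorem expo_add_right (l x z : EuclideanSpace ℝ (Fin d)) :
    expo l (x + z) = expo l x * expo l z := by
  simp only [expo, PiLp.add_apply, mul_add, Finset.sum_add_distrib, neg_add, Real.exp_add]

theorem expo_add_left (l m x : EuclideanSpace ℝ (Fin d)) :
    expo (l + m) x = expo l x * expo m x := by
  simp only [expo, PiLp.add_apply, add_mul, Finset.sum_add_distrib, neg_add, Real.exp_add]

theorem expo_zero (l : EuclideanSpace ℝ (Fin d)) : expo l 0 = 1 := by simp [expo]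

theorem expo_pos (l x : EuclideanSpace ℝ (Fin d)) : 0 < expo l x := Real.exp_pos _

theorem expo_le_one (hl : l ∈ orthant d) {x : EuclideanSpace ℝ (Fin d)} (hx : x ∈ orthant d) :
    expo l x ≤ 1 := Real.exp_le_one_iff.2 (neg_nonpos.2 (sum_mul_nonneg hl hx))

theorem contDiff_expo (l : EuclideanSpace ℝ (Fin d)) : ContDiff ℝ 2 (expo l) := by
  unfold expo
  fun_prop

theorem isC2b_expo (hl : l ∈ orthant d) : IsC2b (expo l) := by
  refine ⟨(contDiff_expo l).contDiffOn, 1, fun x hx => ?_⟩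
  rw [abs_of_pos (expo_pos l x)]
  exact expo_le_one hl hx

theorem pd_expo (l : EuclideanSpace ℝ (Fin d)) (i : Fin d) {x : EuclideanSpace ℝ (Fin d)}
    (hx : x ∈ orthant d) : pd (expo l) i x = -l i * expo l x := by
  have hd : HasFDerivAt (expo l)
      (expo l x • -∑ j, l j • (EuclideanSpace.proj j : EuclideanSpace ℝ (Fin d) →L[ℝ] ℝ)) x := by
    refine HasFDerivAt.exp (HasFDerivAt.neg (HasFDerivAt.fun_sum fun j _ => ?_))
    exact (EuclideanSpace.proj j : EuclideanSpace ℝ (Fin d) →L[ℝ] ℝ).hasFDerivAt.const_mul (l j)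
  rw [pd, hd.hasFDerivWithinAt.fderivWithin (uniqueDiffOn_orthant d x hx)]
  simp [mul_comm]

theorem pd_pd_expo (l : EuclideanSpace ℝ (Fin d)) (i : Fin d) {x : EuclideanSpace ℝ (Fin d)}
    (hx : x ∈ orthant d) : pd (pd (expo l) i) i x = l i ^ 2 * expo l x := by
  have h : EqOn (pd (expo l) i) (fun y => -l i * expo l y + 0 * expo l y) (orthant d) :=
    fun y hy => by rw [pd_expo l i hy]; ring
  have hdiff := ((contDiff_expo l).differentiable (by norm_num) x).differentiableWithinAt
    (s := orthant d)
  rw [pd_congr h i hx, pd_linComb _ _ i hx hdiff hdiff, pd_expo l i hx]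
  ring

/-- Exponentials turn the generator into multiplication by an affine function. -/
theorem gen_expo (p : CBIParams d) (l : EuclideanSpace ℝ (Fin d))
    {x : EuclideanSpace ℝ (Fin d)} (hx : x ∈ orthant d) :
    p.gen (expo l) x = (∑ i, x i * p.phi i l - p.psi l) * expo l x := by
  have h1 : ∫ z : UPos d, (expo l (x + z.1) - expo l x) ∂p.ν
      = expo l x * ∫ z : UPos d, (Real.exp (-∑ j, l j * z.1 j) - 1) ∂p.ν := by
    rw [← integral_const_mul]
    refine integral_congr_ae (ae_of_all _ fun z => ?_)
    change _ = expo l x * (expo l z.1 - 1)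
    simp only [expo_add_right]
    ring
  have h2 : ∀ i, ∫ z : UPos d, (expo l (x + z.1) - expo l x - pd (expo l) i x * min 1 (z.1 i))
      ∂(p.μ i) = expo l x *
        ∫ z : UPos d, (Real.exp (-∑ j, l j * z.1 j) - 1 + l i * min 1 (z.1 i)) ∂(p.μ i) :=
    fun i => by
      rw [← integral_const_mul]
      refine integral_congr_ae (ae_of_all _ fun z => ?_)
      change _ = expo l x * (expo l z.1 - 1 + l i * min 1 (z.1 i))
      simp only [expo_add_right, pd_expo l i hx]
      ring
  have h3 : ∑ i, (∑ j, p.B i j * x j) * l i = ∑ i, x i * ∑ j, p.B j i * l j := by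
    simp only [Finset.sum_mul, Finset.mul_sum]
    rw [Finset.sum_comm]
    exact Finset.sum_congr rfl fun i _ => Finset.sum_congr rfl fun j _ => by ring
  simp only [CBIParams.gen, h1, h2]
  simp only [pd_expo l _ hx, pd_pd_expo l _ hx, CBIParams.phi, CBIParams.psi]
  set J := fun i => ∫ z : UPos d, (Real.exp (-∑ j, l j * z.1 j) - 1 + l i * min 1 (z.1 i)) ∂(p.μ i)
  have e1 : ∑ i, p.c i * x i * (l i ^ 2 * expo l x)
      = (∑ i, x i * (p.c i * l i ^ 2)) * expo l x := by
    rw [Finset.sum_mul]; exact Finset.sum_congr rfl fun i _ => by ring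
  have e2 : ∑ i, (p.β i + ∑ j, p.B i j * x j) * (-l i * expo l x)
      = -(∑ i, p.β i * l i + ∑ i, x i * ∑ j, p.B j i * l j) * expo l x := by
    rw [← h3, ← Finset.sum_add_distrib, ← Finset.sum_neg_distrib, Finset.sum_mul]
    exact Finset.sum_congr rfl fun i _ => by ring
  have e3 : ∑ i, x i * (expo l x * J i) = (∑ i, x i * J i) * expo l x := by
    rw [Finset.sum_mul]; exact Finset.sum_congr rfl fun i _ => by ring
  have e4 : ∑ i, x i * (p.c i * l i ^ 2 - ∑ j, p.B j i * l j + J i)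
      = ∑ i, x i * (p.c i * l i ^ 2) - ∑ i, x i * ∑ j, p.B j i * l j + ∑ i, x i * J i := by
    rw [← Finset.sum_sub_distrib, ← Finset.sum_add_distrib]
    exact Finset.sum_congr rfl fun i _ => by ring
  rw [e1, e2, e3]
  change _ = (∑ i, x i * (p.c i * l i ^ 2 - ∑ j, p.B j i * l j + J i) - _) * _
  rw [e4]
  ring

end expo

namespace CBIParams

variable {d : ℕ} {p : CBIParams d}

theorem zero_mem_orthant (d : ℕ) : (0 : EuclideanSpace ℝ (Fin d)) ∈ orthant d := fun i => by simp

theorem IsAdmissible.integrable_phi (hp : p.IsAdmissible) {l : EuclideanSpace ℝ (Fin d)}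
    (hl : l ∈ orthant d) (i : Fin d) :
    Integrable (fun z : UPos d => Real.exp (-∑ j, l j * z.1 j) - 1 + l i * min 1 (z.1 i))
      (p.μ i) := by
  refine ((isC2b_expo hl).integrable_branching hp (zero_mem_orthant d) i).congr
    (ae_of_all _ fun z => ?_)
  simp only [zero_add, expo_zero, pd_expo l i (zero_mem_orthant d)]
  rw [mul_one, neg_mul, sub_neg_eq_add]
  rfl

/-- The branching mechanism of the superprocess on `{1, …, d}` is that of the CBI process: the
compensator `1 ∧ z_i` is replaced by `z_i`, which changes the linear term from `b_{i,i}` to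
`b̃_{i,i}`. -/
theorem IsAdmissible.toIS_phi (hp : p.IsAdmissible) {l : EuclideanSpace ℝ (Fin d)}
    (hl : l ∈ orthant d) (i : Fin d) : p.toIS.phi i (fun j => l j) = p.phi i l := by
  have h1 : ∫ κ, (Real.exp (-pairing κ.1 fun j => l j) - 1 + (κ.1 {i} : ℝ) * l i) ∂(p.toIS.H₂ i)
      = (∫ z : UPos d, (Real.exp (-∑ j, l j * z.1 j) - 1 + l i * min 1 (z.1 i)) ∂(p.μ i))
        + l i * (p.Btilde i i - p.B i i) := by
    rw [toIS_H₂, integral_map measurable_uToM.aemeasurable]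
    · rw [Btilde, add_sub_cancel_left, ← integral_const_mul,
        ← integral_add (hp.integrable_phi hl i) ((hp.integrable_max i i).const_mul _)]
      refine integral_congr_ae (ae_of_all _ fun z => ?_)
      have hz : ((uToM z).1 {i} : ℝ) = z.1 i := by
        change ((ofVec fun i => z.1 i) {i} : ℝ) = _
        rw [ofVec_singleton, Real.coe_toNNReal _ (z.2.1 i)]
      have hmm : min 1 (z.1 i) + max (z.1 i - 1) 0 = z.1 i := by
        rcases le_total (z.1 i) 1 with h | h
        · rw [max_eq_right (by linarith), min_eq_right h, add_zero]
        · rw [max_eq_left (by linarith), min_eq_left h, add_sub_cancel]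
      simp only [pairing_uToM, hz, if_true]
      rw [Finset.sum_congr rfl fun j _ => mul_comm (z.1 j) (l j), add_assoc, ← mul_add, hmm,
        mul_comm (l i)]
    · refine Measurable.aestronglyMeasurable ?_
      exact (((measurable_pairing_fin _).comp measurable_subtype_coe).neg.exp.sub_const _).add
        (((measurable_apply_fin i).comp measurable_subtype_coe).mul_const _)
  have h2 : ∫ y, l y ∂(p.toIS.B i) = ∑ j, p.B j i * l j - p.B i i * l i := by
    change pairing (ofVec fun j => if j = i then 0 else p.B j i) (fun j => l j) = _
    rw [pairing_fin, eq_sub_iff_add_eq, ← Finset.add_sum_erase _ _ (Finset.mem_univ i),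
      ← Finset.add_sum_erase _ (fun j => p.B j i * l j) (Finset.mem_univ i)]
    simp only [ofVec_singleton, if_true, Real.toNNReal_zero, NNReal.coe_zero, zero_mul, zero_add]
    rw [add_comm]
    congr 1
    refine Finset.sum_congr rfl fun j hj => ?_
    have hne := Finset.ne_of_mem_erase hj
    rw [if_neg hne, Real.coe_toNNReal _ (hp.B_nonneg j i hne)]
  rw [ISParams.phi, h1, h2, phi]
  change p.c i * l i ^ 2 + -p.Btilde i i * l i - _ + _ = _
  ring

theorem IsAdmissible.toIS_immigration (hp : p.IsAdmissible)
    (l : EuclideanSpace ℝ (Fin d)) :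
    p.toIS.immigration (fun j => l j) = p.psi l := by
  have h1 : ∫ κ, (1 - Real.exp (-pairing κ.1 fun j => l j)) ∂p.toIS.H₁
      = -∫ z : UPos d, (Real.exp (-∑ j, l j * z.1 j) - 1) ∂p.ν := by
    change ∫ κ, _ ∂(p.ν.map uToM) = _
    rw [integral_map measurable_uToM.aemeasurable, ← integral_neg]
    · refine integral_congr_ae (ae_of_all _ fun z => ?_)
      simp only [pairing_uToM]
      rw [Finset.sum_congr rfl fun j _ => mul_comm (z.1 j) (l j)]
      ring
    · refine Measurable.aestronglyMeasurable ?_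
      exact measurable_const.sub ((measurable_pairing_fin _).comp measurable_subtype_coe).neg.exp
  have h2 : pairing p.toIS.β (fun j => l j) = ∑ j, p.β j * l j := by
    change pairing (ofVec p.β) _ = _
    rw [pairing_fin]
    exact Finset.sum_congr rfl fun j _ => by
      rw [ofVec_singleton, Real.coe_toNNReal _ (hp.β_nonneg j)]
  rw [ISParams.immigration, h1, h2, psi, sub_eq_add_neg]

theorem IsAdmissible.continuousOn_phi (hp : p.IsAdmissible) (i : Fin d) :
    ContinuousOn (p.phi i) (orthant d) := by
  refine ContinuousOn.add (Continuous.continuousOn (by fun_prop)) fun l hl => ?_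
  set M := ‖l‖ + 1 with hM
  have hM0 : 0 ≤ M := by positivity
  have hnear : ∀ᶠ y in 𝓝[orthant d] l, y ∈ orthant d ∧ ‖y‖ ≤ M :=
    eventually_mem_nhdsWithin.and (mem_nhdsWithin_of_mem_nhds
      ((continuous_norm.tendsto l).eventually_le_const (lt_add_one _)))
  set D : ℝ := d * M
  refine continuousWithinAt_of_dominated (bound := fun z => (D + D ^ 2) * min ‖z.1‖ (‖z.1‖ ^ 2)
    + ∑ j, M * max (z.1 j - if j = i then 1 else 0) 0) ?_ ?_
    (((hp.integrable_min i).const_mul _).add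
      (integrable_finsetSum _ fun j _ => (hp.integrable_max j i).const_mul _))
    (ae_of_all _ fun z => ?_)
  · exact Eventually.of_forall fun y => (by fun_prop : Measurable fun z : UPos d =>
      Real.exp (-∑ j, y j * z.1 j) - 1 + y i * min 1 (z.1 i)).aestronglyMeasurable
  · filter_upwards [hnear] with y hy
    refine ae_of_all _ fun z => ?_
    have hb := IsC2b.branching_eq_taylor_add (expo y) 0 i z
    simp only [zero_add, expo_zero, pd_expo y _ (zero_mem_orthant d), mul_one] at hb
    have hb' : Real.exp (-∑ j, y j * z.1 j) - 1 + y i * min 1 (z.1 i)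
        = (Real.exp (-∑ j, y j * z.1 j) - 1 + ∑ j, y j * z.1 j)
          - ∑ j, y j * max (z.1 j - if j = i then 1 else 0) 0 := by
      have e1 : ∑ j, z.1 j * -y j = -∑ j, y j * z.1 j := by
        rw [← Finset.sum_neg_distrib]
        exact Finset.sum_congr rfl fun j _ => by ring
      have e2 : ∑ j, -y j * max (z.1 j - if j = i then 1 else 0) 0
          = -∑ j, y j * max (z.1 j - if j = i then 1 else 0) 0 := by
        rw [← Finset.sum_neg_distrib]
        exact Finset.sum_congr rfl fun j _ => by ring
      rw [e1, e2] at hb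
      unfold expo at hb
      linarith
    rw [hb']
    have hs0 := sum_mul_nonneg hy.1 z.2.1
    refine (norm_sub_le _ _).trans (add_le_add ?_ ?_)
    · rw [Real.norm_of_nonneg (exp_neg_sub_one_add_nonneg _)]
      refine (exp_neg_sub_one_add_le hs0).trans
        (min_sq_le (norm_nonneg _) (by positivity) hs0 ((sum_mul_le z.2.1).trans ?_))
      gcongr
      exact mul_le_mul_of_nonneg_left hy.2 (Nat.cast_nonneg d)
    · refine (norm_sum_le _ _).trans (Finset.sum_le_sum fun j _ => ?_)
      rw [norm_mul, Real.norm_of_nonneg (le_max_right _ (0 : ℝ)), Real.norm_of_nonneg (hy.1 j)]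
      exact mul_le_mul_of_nonneg_right ((coord_le_norm y j).trans hy.2) (le_max_right _ _)
  · exact (Continuous.continuousAt (by fun_prop)).continuousWithinAt

theorem IsAdmissible.continuousOn_psi (hp : p.IsAdmissible) :
    ContinuousOn p.psi (orthant d) := by
  refine ContinuousOn.sub (Continuous.continuousOn (by fun_prop)) fun l hl => ?_
  set M := ‖l‖ + 1 with hM
  have hM0 : 0 ≤ M := by positivity
  have hnear : ∀ᶠ y in 𝓝[orthant d] l, y ∈ orthant d ∧ ‖y‖ ≤ M :=
    eventually_mem_nhdsWithin.and (mem_nhdsWithin_of_mem_nhds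
      ((continuous_norm.tendsto l).eventually_le_const (lt_add_one _)))
  refine continuousWithinAt_of_dominated (bound := fun z => (1 + d * M) * min 1 ‖z.1‖) ?_ ?_
    (hp.integrable_min_one.const_mul _) (ae_of_all _ fun z => ?_)
  · exact Eventually.of_forall fun y => (by fun_prop : Measurable fun z : UPos d =>
      Real.exp (-∑ j, y j * z.1 j) - 1).aestronglyMeasurable
  · filter_upwards [hnear] with y hy
    refine ae_of_all _ fun z => ?_
    have hs0 := sum_mul_nonneg hy.1 z.2.1
    have hs1 : ∑ j, y j * z.1 j ≤ d * M * ‖z.1‖ := (sum_mul_le z.2.1).trans (by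
      gcongr
      exact hy.2)
    have h1 : Real.exp (-∑ j, y j * z.1 j) ≤ 1 := Real.exp_le_one_iff.2 (by linarith)
    have h2 := exp_neg_sub_one_add_nonneg (∑ j, y j * z.1 j)
    have h3 := Real.exp_pos (-∑ j, y j * z.1 j)
    have h4 : (0 : ℝ) ≤ d * M := by positivity
    rw [Real.norm_eq_abs, abs_of_nonpos (by linarith)]
    rcases le_total 1 ‖z.1‖ with h | h
    · rw [min_eq_left h]; linarith
    · rw [min_eq_right h]; nlinarith [norm_nonneg z.1]
  · exact (Continuous.continuousAt (by fun_prop)).continuousWithinAt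

/-- On bounded sets `φ_i(l) ≤ K l_i`; this keeps cumulants away from the boundary. -/
theorem IsAdmissible.exists_phi_le (hp : p.IsAdmissible) (i : Fin d) (M : ℝ) :
    ∃ K, ∀ l ∈ orthant d, ‖l‖ ≤ M → p.phi i l ≤ K * l i := by
  set J := ∫ z : UPos d, min ‖z.1‖ (‖z.1‖ ^ 2) ∂(p.μ i) with hJ
  have hJ0 : 0 ≤ J := integral_nonneg fun z => by positivity
  refine ⟨(p.c i + J) * M - p.B i i, fun l hl hlM => ?_⟩
  have h1 : ∫ z : UPos d, (Real.exp (-∑ j, l j * z.1 j) - 1 + l i * min 1 (z.1 i)) ∂(p.μ i)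
      ≤ l i ^ 2 * J := by
    rw [hJ, ← integral_const_mul]
    refine integral_mono (hp.integrable_phi hl i) ((hp.integrable_min i).const_mul _) fun z => ?_
    have hz0 := z.2.1 i
    have hm0 : 0 ≤ min 1 (z.1 i) := le_min zero_le_one hz0
    have hm1 : min 1 (z.1 i) ≤ 1 := min_le_left _ _
    have hmz : min 1 (z.1 i) ≤ ‖z.1‖ := (min_le_right _ _).trans (coord_le_norm _ _)
    have ha : l i * min 1 (z.1 i) ≤ ∑ j, l j * z.1 j :=
      (mul_le_mul_of_nonneg_left (min_le_right _ _) (hl i)).trans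
        (Finset.single_le_sum (f := fun j => l j * z.1 j)
          (fun j _ => mul_nonneg (hl j) (z.2.1 j)) (Finset.mem_univ i))
    have hexp : Real.exp (-∑ j, l j * z.1 j) ≤ Real.exp (-(l i * min 1 (z.1 i))) :=
      Real.exp_le_exp.2 (by linarith)
    have h2 := (exp_neg_sub_one_add_le (mul_nonneg (hl i) hm0)).trans (min_le_right _ _)
    have h3 : min 1 (z.1 i) ^ 2 ≤ min ‖z.1‖ (‖z.1‖ ^ 2) :=
      le_min (by nlinarith) (pow_le_pow_left₀ hm0 hmz 2)
    calc Real.exp (-∑ j, l j * z.1 j) - 1 + l i * min 1 (z.1 i)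
        ≤ (l i * min 1 (z.1 i)) ^ 2 := by linarith
      _ = l i ^ 2 * min 1 (z.1 i) ^ 2 := mul_pow _ _ _
      _ ≤ _ := mul_le_mul_of_nonneg_left h3 (sq_nonneg _)
  have h2 : p.B i i * l i ≤ ∑ j, p.B j i * l j := by
    rw [← Finset.add_sum_erase _ _ (Finset.mem_univ i)]
    exact le_add_of_nonneg_right (Finset.sum_nonneg fun j hj =>
      mul_nonneg (hp.B_nonneg j i (Finset.ne_of_mem_erase hj)) (hl j))
  have h3 : l i ^ 2 ≤ M * l i := by nlinarith [hl i, (coord_le_norm l i).trans hlM]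
  have h4 : 0 ≤ p.c i + J := add_nonneg (hp.c_nonneg i) hJ0
  rw [phi]
  nlinarith [mul_le_mul_of_nonneg_left h3 h4]

end CBIParams
/-! ### From cumulant semigroups of the superprocess to those of the CBI process -/

theorem hasDerivWithinAt_euclidean {d : ℕ} {v : ℝ → EuclideanSpace ℝ (Fin d)}
    {v' : EuclideanSpace ℝ (Fin d)} {s : Set ℝ} {t : ℝ} :
    HasDerivWithinAt v v' s t ↔ ∀ i, HasDerivWithinAt (fun r => v r i) (v' i) s t := by
  rw [hasDerivWithinAt_iff_hasFDerivWithinAt, hasFDerivWithinAt_euclidean]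
  refine forall_congr' fun i => ?_
  rw [hasDerivWithinAt_iff_hasFDerivWithinAt]
  refine iff_of_eq (congrArg (fun L => HasFDerivWithinAt _ L s t) ?_)
  ext
  simp

namespace CBIParams

variable {d : ℕ} {p : CBIParams d}

/-- On a discrete space without motion the integral equation for the cumulant semigroup is an
integrated ordinary differential equation; as the branching mechanism is continuous, measurable
locally bounded solutions are continuously differentiable. -/
theorem IsAdmissible.isCumulant_of_toIS (hp : p.IsAdmissible) {l : EuclideanSpace ℝ (Fin d)}
    {V : ℝ → Fin d → ℝ} (hV : p.toIS.IsCumulant (fun j => l j) V) :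
    p.IsCumulant l fun t => WithLp.toLp 2 (V t) := by
  set v : ℝ → EuclideanSpace ℝ (Fin d) := fun t => WithLp.toLp 2 (V t) with hv
  have hmem : ∀ t, 0 ≤ t → v t ∈ orthant d := fun t ht i => hV.nonneg t ht i
  -- extension of the solution to negative times by its initial value
  set w : ℝ → EuclideanSpace ℝ (Fin d) := fun t => v (max t 0) with hw
  have hwmem : ∀ t, w t ∈ orthant d := fun t => hmem _ (le_max_right _ _)
  have hwv : ∀ t, 0 ≤ t → w t = v t := fun t ht => by simp only [hw, max_eq_left ht]
  have hVm : ∀ i, Measurable fun t => V t i := fun i =>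
    hV.measurable.comp (measurable_id.prodMk measurable_const)
  have hwm : Measurable w := by
    refine (PiLp.continuous_toLp 2 _).measurable.comp (measurable_pi_lambda _ fun i => ?_)
    exact (hVm i).comp (measurable_id.max measurable_const)
  have hφw : ∀ i, Measurable fun t => p.phi i (w t) := fun i => by
    have h1 : Measurable fun y : Orthant d => p.phi i y.1 :=
      (continuousOn_iff_continuous_domRestrict.1 (hp.continuousOn_phi i)).measurable
    exact h1.comp (hwm.subtype_mk (h := hwmem))
  have hint : ∀ i a b, IntervalIntegrable (fun t => p.phi i (w t)) volume a b := fun i a b => by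
    obtain ⟨K, hK⟩ := hV.locally_bounded (max (max a b) 0)
    obtain ⟨N, hN⟩ := ((isCompact_closedBall (0 : EuclideanSpace ℝ (Fin d))
      (d * |K|)).inter_left (isClosed_orthant d)).exists_bound_of_continuousOn
        ((hp.continuousOn_phi i).mono inter_subset_left)
    rw [intervalIntegrable_iff]
    refine Measure.integrableOn_of_bounded (M := N) (by simp)
      (hφw i).aestronglyMeasurable ?_
    refine (ae_restrict_iff' measurableSet_uIoc).2 (ae_of_all _ fun t ht => ?_)
    have ht' : t ≤ max a b := ht.2
    refine hN _ ⟨hwmem t, ?_⟩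
    rw [mem_closedBall_zero_iff]
    refine (norm_le_sum_coord (hwmem t)).trans ?_
    have : ∀ j ∈ Finset.univ, w t j ≤ |K| := fun j _ =>
      (hK _ ⟨le_max_right _ _, max_le_max_right 0 ht'⟩ j).trans (le_abs_self K)
    simpa using Finset.sum_le_card_nsmul _ _ _ this
  have heq : ∀ t, 0 ≤ t → ∀ i, v t i = l i - ∫ s in (0 : ℝ)..t, p.phi i (w s) := fun t ht i => by
    have h := hV.equation t ht i
    change V t i = ∫ y, l y ∂(Kernel.id i) - ∫ s in (0 : ℝ)..t,
      ∫ y, p.toIS.phi y (V s) ∂(Kernel.id i) at h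
    simp only [Kernel.id_apply, integral_dirac] at h
    change V t i = _
    rw [h]
    congr 1
    refine intervalIntegral.integral_congr fun s hs => ?_
    rw [uIcc_of_le ht] at hs
    rw [hwv s hs.1, ← hp.toIS_phi (hmem s hs.1) i]
  have hwc : Continuous w := by
    refine (PiLp.continuous_toLp 2 _).comp (continuous_pi fun i => ?_)
    have h1 : ∀ t, V (max t 0) i = l i - ∫ s in (0 : ℝ)..(max t 0), p.phi i (w s) := fun t =>
      heq _ (le_max_right _ _) i
    simp only [h1]
    exact continuous_const.sub ((intervalIntegral.continuous_primitive (hint i) 0).comp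
      (continuous_id.max continuous_const))
  have hφc : ∀ i, Continuous fun t => p.phi i (w t) := fun i =>
    (hp.continuousOn_phi i).comp_continuous hwc hwmem
  set u : ℝ → EuclideanSpace ℝ (Fin d) := fun t =>
    WithLp.toLp 2 fun i => l i - ∫ s in (0 : ℝ)..t, p.phi i (w s) with hu
  have huv : ∀ t, 0 ≤ t → v t = u t := fun t ht => by
    ext i
    exact heq t ht i
  have hder : ∀ t, HasDerivAt u (WithLp.toLp 2 fun i => -p.phi i (w t)) t := fun t => by
    rw [← hasDerivWithinAt_univ]
    refine hasDerivWithinAt_euclidean.2 fun i => HasDerivAt.hasDerivWithinAt ?_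
    exact (intervalIntegral.integral_hasDerivAt_right (hint i 0 t)
      ((hφc i).stronglyMeasurableAtFilter _ _) (hφc i).continuousAt).const_sub (l i)
  refine ⟨hmem, ?_, ?_, fun t ht => ?_⟩
  · ext i
    rw [heq 0 le_rfl i]
    simp
  · have : ContDiff ℝ 1 u := by
      refine contDiff_one_iff_deriv.2 ⟨fun t => (hder t).differentiableAt, ?_⟩
      have : deriv u = fun t => WithLp.toLp 2 fun i => -p.phi i (w t) :=
        funext fun t => (hder t).deriv
      rw [this]
      exact (PiLp.continuous_toLp 2 _).comp (continuous_pi fun i => (hφc i).neg)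
    exact this.contDiffOn.congr fun t ht => huv t ht
  · have := (hder t).hasDerivWithinAt (s := Ici 0)
    rw [hwv t ht] at this
    exact this.congr (fun s hs => huv s hs) (huv t ht)

theorem IsCumulant.hasDerivWithinAt_coord {l : EuclideanSpace ℝ (Fin d)}
    {v : ℝ → EuclideanSpace ℝ (Fin d)} (hv : p.IsCumulant l v) {t : ℝ} (ht : 0 ≤ t) (i : Fin d) :
    HasDerivWithinAt (fun s => v s i) (-p.phi i (v t)) (Ici 0) t :=
  hasDerivWithinAt_euclidean.1 (hv.equation t ht) i

theorem IsAdmissible.cumulant_pos (hp : p.IsAdmissible) {l : EuclideanSpace ℝ (Fin d)}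
    {v : ℝ → EuclideanSpace ℝ (Fin d)} (hv : p.IsCumulant l v) {i : Fin d} (hl : 0 < l i) {t : ℝ}
    (ht : 0 ≤ t) : 0 < v t i := by
  obtain ⟨M, hM⟩ := (isCompact_Icc (a := (0 : ℝ)) (b := t)).exists_bound_of_continuousOn
    (hv.smooth.continuousOn.mono Icc_subset_Ici_self)
  obtain ⟨K, hK⟩ := hp.exists_phi_le i M
  -- Gronwall: `e^{Ks} v_i(s)` is nondecreasing because `φ_i(v) ≤ K v_i`
  have hder : ∀ s, 0 ≤ s → HasDerivWithinAt (fun s => Real.exp (K * s) * v s i)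
      (Real.exp (K * s) * (K * v s i - p.phi i (v s))) (Ici 0) s := fun s hs => by
    have h1 : HasDerivWithinAt (fun s : ℝ => Real.exp (K * s)) (Real.exp (K * s) * K) (Ici 0) s := by
      simpa using ((hasDerivAt_id s).const_mul K).exp.hasDerivWithinAt
    exact (h1.fun_mul (hv.hasDerivWithinAt_coord hs i)).congr_deriv (by ring)
  have hmono : MonotoneOn (fun s => Real.exp (K * s) * v s i) (Icc 0 t) := by
    refine monotoneOn_of_hasDerivWithinAt_nonneg (convex_Icc 0 t)
      (f' := fun s => Real.exp (K * s) * (K * v s i - p.phi i (v s)))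
      (fun s hs => ((hder s hs.1).mono Icc_subset_Ici_self).continuousWithinAt)
      (fun s hs => (hder s ((interior_subset hs).1)).mono
        (interior_subset.trans Icc_subset_Ici_self)) fun s hs => ?_
    have hs' := interior_subset hs
    exact mul_nonneg (Real.exp_nonneg _)
      (sub_nonneg.2 (hK _ (hv.mem_orthant s hs'.1) (hM s hs')))
  have h := hmono ⟨le_rfl, ht⟩ ⟨ht, le_rfl⟩ ht
  simp only [mul_zero, Real.exp_zero, one_mul, hv.initial] at h
  exact pos_of_mul_pos_right (hl.trans_le h) (Real.exp_nonneg _)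

/-- The transition semigroup on the orthant obtained from one on the finite measures on
`{1, …, d}` by passing to coordinates. -/
noncomputable def toOrthant (Q : ℝ≥0 → Kernel (FiniteMeasure (Fin d)) (FiniteMeasure (Fin d)))
    (t : ℝ≥0) : Kernel (Orthant d) (Orthant d) :=
  ((Q t).map toVec).comap (fun x => ofVec fun i => x.1 i) measurable_ofVec

variable {Q : ℝ≥0 → Kernel (FiniteMeasure (Fin d)) (FiniteMeasure (Fin d))}

theorem toOrthant_apply (t : ℝ≥0) (x : Orthant d) :
    toOrthant Q t x = (Q t (ofVec fun i => x.1 i)).map toVec := by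
  rw [toOrthant, Kernel.comap_apply, Kernel.map_apply _ measurable_toVec]

theorem toOrthant_toVec (t : ℝ≥0) (κ : FiniteMeasure (Fin d)) :
    toOrthant Q t (toVec κ) = (Q t κ).map toVec := by
  rw [toOrthant_apply, ofVec_toVec]

theorem isTransitionSemigroup_toOrthant (hQ : IsTransitionSemigroup Q) :
    IsTransitionSemigroup (toOrthant Q) := by
  refine ⟨fun t => ⟨fun x => ?_⟩, ?_, fun s t => ?_⟩
  · have := hQ.markov t
    rw [toOrthant_apply]
    exact Measure.isProbabilityMeasure_map measurable_toVec.aemeasurable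
  · refine Kernel.ext fun x => ?_
    rw [toOrthant_apply, hQ.zero, Kernel.id_apply, Kernel.id_apply,
      Measure.map_dirac' measurable_toVec, toVec_ofVec]
  · ext x A hA
    have hA' := measurable_toVec hA
    rw [Kernel.comp_apply' _ _ _ hA, toOrthant_apply, toOrthant_apply,
      Measure.map_apply measurable_toVec hA, hQ.add, Kernel.comp_apply' _ _ _ hA',
      lintegral_map (Kernel.measurable_coe _ hA) measurable_toVec]
    refine lintegral_congr fun κ => ?_
    rw [toOrthant_toVec, Measure.map_apply measurable_toVec hA]

theorem isMarkovProcess_toOrthant {Ω : Type*} [mΩ : MeasurableSpace Ω] {Pr : Measure Ω}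
    {𝓖 : Filtration ℝ≥0 mΩ} {Y : ℝ≥0 → Ω → FiniteMeasure (Fin d)}
    (hY : IsMarkovProcess Pr 𝓖 Y Q) :
    IsMarkovProcess Pr 𝓖 (fun t ω => toVec (Y t ω)) (toOrthant Q) := by
  refine ⟨fun t => measurable_toVec.comp (hY.adapted t), fun s t A hA => ?_⟩
  have h := hY.markov s t _ (measurable_toVec hA)
  have h' : (fun ω => (toOrthant Q t (toVec (Y s ω))).real A)
      = fun ω => (Q t (Y s ω)).real (toVec ⁻¹' A) := by
    funext ω
    rw [toOrthant_toVec, map_measureReal_apply measurable_toVec hA]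
  rw [h']
  exact h

theorem IsAdmissible.laplace_toOrthant (hp : p.IsAdmissible) (hQ : p.toIS.IsSemigroup Q)
    (l : Orthant d) : ∃ v : ℝ → EuclideanSpace ℝ (Fin d), p.IsCumulant l.1 v ∧
      ∀ (t : ℝ≥0) (x : Orthant d),
        ∫ y : Orthant d, Real.exp (-∑ j, l.1 j * y.1 j) ∂(toOrthant Q t x)
          = Real.exp (-∑ j, x.1 j * v t j - ∫ s in (0 : ℝ)..t, p.psi (v s)) := by
  obtain ⟨V, hV, h⟩ := hQ.laplace (fun j => l.1 j) (measurable_of_finite _) (fun j => l.2 j)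
    ⟨‖l.1‖, fun j => coord_le_norm l.1 j⟩
  refine ⟨_, hp.isCumulant_of_toIS hV, fun t x => ?_⟩
  have h1 : ∫ y : Orthant d, Real.exp (-∑ j, l.1 j * y.1 j) ∂(toOrthant Q t x)
      = ∫ κ, Real.exp (-pairing κ fun j => l.1 j) ∂(Q t (ofVec fun i => x.1 i)) := by
    rw [toOrthant_apply, integral_map measurable_toVec.aemeasurable
      (Measurable.aestronglyMeasurable (by fun_prop))]
    refine integral_congr_ae (ae_of_all _ fun κ => ?_)
    simp only [pairing_fin]
    rw [Finset.sum_congr rfl fun j _ => mul_comm (l.1 j) _]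
    rfl
  have h2 : ∀ s, p.toIS.immigration (V s) = p.psi (WithLp.toLp 2 (V s)) := fun s =>
    hp.toIS_immigration (WithLp.toLp 2 (V s))
  rw [h1, h, pairing_ofVec x.2]
  simp only [h2]

end CBIParams
/-! ### Small time expansion of exponentials -/

theorem abs_exp_neg_sub_one_add_le (A : ℝ) :
    |Real.exp (-A) - 1 + A| ≤ A ^ 2 * Real.exp |A| := by
  have he : 1 ≤ Real.exp |A| := Real.one_le_exp (abs_nonneg A)
  rw [abs_of_nonneg (exp_neg_sub_one_add_nonneg A)]
  rcases le_or_gt 0 A with h | h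
  · refine ((exp_neg_sub_one_add_le h).trans (min_le_right _ _)).trans ?_
    nlinarith [sq_nonneg A]
  · rcases le_or_gt (-1) A with h1 | h1
    · have := Real.abs_exp_sub_one_sub_id_le (x := -A) (by rw [abs_of_pos] <;> linarith)
      have h2 := le_abs_self (Real.exp (-A) - 1 - -A)
      nlinarith [sq_nonneg A]
    · rw [abs_of_neg h] at he ⊢
      nlinarith [Real.exp_pos (-A), mul_nonneg (Real.exp_pos (-A)).le
        (by nlinarith : 0 ≤ A ^ 2 - 1)]

theorem one_add_sq_le_exp {δ S : ℝ} (hδ : 0 < δ) (hS : 0 ≤ S) :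
    (1 + S) ^ 2 ≤ (1 + 2 / δ) ^ 2 * Real.exp (δ * S) := by
  have h1 : 1 + S ≤ (1 + 2 / δ) * (1 + δ / 2 * S) := by
    have : (1 + 2 / δ) * (1 + δ / 2 * S) = 1 + S + 2 / δ + δ / 2 * S := by field_simp; ring
    rw [this]
    have : 0 ≤ 2 / δ + δ / 2 * S := by positivity
    linarith
  have h2 : 1 + δ / 2 * S ≤ Real.exp (δ / 2 * S) := by
    rw [add_comm]; exact Real.add_one_le_exp _
  have h3 : 1 + S ≤ (1 + 2 / δ) * Real.exp (δ / 2 * S) :=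
    h1.trans (mul_le_mul_of_nonneg_left h2 (by positivity))
  calc (1 + S) ^ 2 ≤ ((1 + 2 / δ) * Real.exp (δ / 2 * S)) ^ 2 :=
        pow_le_pow_left₀ (by linarith) h3 2
    _ = _ := by rw [mul_pow, ← Real.exp_nat_mul]; congr 2; push_cast; ring

theorem expo_le_exp {d : ℕ} {l x : EuclideanSpace ℝ (Fin d)} {δ : ℝ} (hl : ∀ i, δ ≤ l i)
    (hx : x ∈ orthant d) : expo l x ≤ Real.exp (-(δ * ∑ i, x i)) := by
  refine Real.exp_le_exp.2 (neg_le_neg ?_)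
  rw [Finset.mul_sum]
  exact Finset.sum_le_sum fun i _ => mul_le_mul_of_nonneg_right (hl i) (hx i)

/-- First order expansion of an exponential in its exponent, uniformly over the orthant. The
factors `x_i` produced by differentiation are absorbed by the decay of `e^{-⟨l, x⟩}`. -/
theorem abs_exp_sub_expo_le {d : ℕ} {l v x : EuclideanSpace ℝ (Fin d)} {δ : ℝ} (hδ : 0 < δ)
    (hl : ∀ i, 2 * δ ≤ l i) (hx : x ∈ orthant d) {φ : Fin d → ℝ} {ψ a t ε C : ℝ} (ht : 0 ≤ t)
    (hε : 0 ≤ ε) (hε1 : ε ≤ 1) (hC : C = 1 + ∑ i, |φ i| + |ψ|) (hCt : C * t ≤ δ)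
    (hv : ∀ i, |v i - l i + t * φ i| ≤ ε * t) (ha : |a - t * ψ| ≤ ε * t) :
    |Real.exp (-∑ i, x i * v i - a) - expo l x - t * ((∑ i, x i * φ i - ψ) * expo l x)|
      ≤ (1 + 2 / δ) ^ 2 * Real.exp δ * (C ^ 2 * t ^ 2 + ε * t) := by
  set S := ∑ i, x i with hS
  have hS0 : 0 ≤ S := Finset.sum_nonneg fun i _ => hx i
  set A := ∑ i, x i * (v i - l i) + a with hA
  have hC0 : 0 ≤ C := by rw [hC]; positivity
  have hCφ : ∀ i, 1 + |φ i| ≤ C := fun i => by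
    have := Finset.single_le_sum (f := fun i => |φ i|) (fun i _ => abs_nonneg _)
      (Finset.mem_univ i)
    have h2 := abs_nonneg ψ
    rw [hC]; linarith
  have hCψ : 1 + |ψ| ≤ C := by
    have : 0 ≤ ∑ i, |φ i| := Finset.sum_nonneg fun i _ => abs_nonneg _
    rw [hC]; linarith
  have hvl : ∀ i, |v i - l i| ≤ C * t := fun i => by
    have h1 : |v i - l i| ≤ |v i - l i + t * φ i| + |t * φ i| := by
      have := abs_sub (v i - l i + t * φ i) (t * φ i)
      rwa [add_sub_cancel_right] at this
    rw [abs_mul, abs_of_nonneg ht] at h1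
    nlinarith [hv i, hCφ i]
  have haC : |a| ≤ C * t := by
    have h1 : |a| ≤ |a - t * ψ| + |t * ψ| := by
      have := abs_add_le (a - t * ψ) (t * ψ)
      rwa [sub_add_cancel] at this
    rw [abs_mul, abs_of_nonneg ht] at h1
    nlinarith
  have hAabs : |A| ≤ (1 + S) * (C * t) := by
    refine (abs_add_le _ _).trans ?_
    have : |∑ i, x i * (v i - l i)| ≤ S * (C * t) := by
      rw [hS, Finset.sum_mul]
      refine (Finset.abs_sum_le_sum_abs _ _).trans (Finset.sum_le_sum fun i _ => ?_)
      rw [abs_mul, abs_of_nonneg (hx i)]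
      exact mul_le_mul_of_nonneg_left (hvl i) (hx i)
    linarith
  have hlin : |A + t * (∑ i, x i * φ i - ψ)| ≤ (1 + S) * (ε * t) := by
    have h1 : A + t * (∑ i, x i * φ i - ψ)
        = ∑ i, x i * (v i - l i + t * φ i) + (a - t * ψ) := by
      have : ∑ i, x i * (v i - l i + t * φ i)
          = ∑ i, x i * (v i - l i) + t * ∑ i, x i * φ i := by
        rw [Finset.mul_sum, ← Finset.sum_add_distrib]
        exact Finset.sum_congr rfl fun i _ => by ring
      rw [this, hA]; ring
    rw [h1]
    refine (abs_add_le _ _).trans ?_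
    have : |∑ i, x i * (v i - l i + t * φ i)| ≤ S * (ε * t) := by
      rw [hS, Finset.sum_mul]
      refine (Finset.abs_sum_le_sum_abs _ _).trans (Finset.sum_le_sum fun i _ => ?_)
      rw [abs_mul, abs_of_nonneg (hx i)]
      exact mul_le_mul_of_nonneg_left (hv i) (hx i)
    linarith
  have hexp : Real.exp (-∑ i, x i * v i - a) = expo l x * Real.exp (-A) := by
    rw [expo, ← Real.exp_add]
    congr 1
    have : ∑ i, x i * (v i - l i) = ∑ i, x i * v i - ∑ i, l i * x i := by
      rw [← Finset.sum_sub_distrib]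
      exact Finset.sum_congr rfl fun i _ => by ring
    rw [hA, this]; ring
  have he := expo_le_exp hl hx
  rw [← hS] at he
  have hq := one_add_sq_le_exp hδ hS0
  set L := (1 + 2 / δ) ^ 2
  have hL0 : 0 ≤ L := sq_nonneg _
  have hquad : expo l x * (A ^ 2 * Real.exp |A|) ≤ L * Real.exp δ * (C ^ 2 * t ^ 2) := by
    have h1 : A ^ 2 ≤ (1 + S) ^ 2 * (C ^ 2 * t ^ 2) := by
      rw [← sq_abs A]
      exact (pow_le_pow_left₀ (abs_nonneg _) hAabs 2).trans_eq (by ring)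
    have h2 : Real.exp |A| ≤ Real.exp δ * Real.exp (δ * S) := by
      rw [← Real.exp_add]
      refine Real.exp_le_exp.2 (hAabs.trans ?_)
      nlinarith
    calc expo l x * (A ^ 2 * Real.exp |A|)
        ≤ Real.exp (-(2 * δ * S)) * ((L * Real.exp (δ * S) * (C ^ 2 * t ^ 2))
            * (Real.exp δ * Real.exp (δ * S))) := by
          refine mul_le_mul he (mul_le_mul (h1.trans ?_) h2 (Real.exp_nonneg _) (by positivity))
            (by positivity) (Real.exp_nonneg _)
          exact mul_le_mul_of_nonneg_right hq (by positivity)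
      _ = L * Real.exp δ * (C ^ 2 * t ^ 2)
            * (Real.exp (-(2 * δ * S)) * (Real.exp (δ * S) * Real.exp (δ * S))) := by ring
      _ = _ := by
          rw [← Real.exp_add, ← Real.exp_add]
          have : -(2 * δ * S) + (δ * S + δ * S) = 0 := by ring
          rw [this, Real.exp_zero, mul_one]
  have hline : expo l x * ((1 + S) * (ε * t)) ≤ L * Real.exp δ * (ε * t) := by
    have h1 : 1 + S ≤ L * Real.exp (2 * δ * S) := by
      have h2 : Real.exp (δ * S) ≤ Real.exp (2 * δ * S) :=
        Real.exp_le_exp.2 (by nlinarith [mul_nonneg hδ.le hS0])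
      nlinarith [mul_le_mul_of_nonneg_left h2 hL0]
    calc expo l x * ((1 + S) * (ε * t))
        ≤ Real.exp (-(2 * δ * S)) * ((L * Real.exp (2 * δ * S)) * (ε * t)) := by
          refine mul_le_mul he (mul_le_mul_of_nonneg_right h1 (by positivity)) (by positivity)
            (Real.exp_nonneg _)
      _ = L * (ε * t) * (Real.exp (-(2 * δ * S)) * Real.exp (2 * δ * S)) := by ring
      _ = L * (ε * t) := by rw [← Real.exp_add, neg_add_cancel, Real.exp_zero, mul_one]
      _ ≤ _ := by
          have : 1 ≤ Real.exp δ := Real.one_le_exp hδ.le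
          have h0 : 0 ≤ L * (ε * t) := by positivity
          nlinarith
  have hsplit : expo l x * Real.exp (-A) - expo l x - t * ((∑ i, x i * φ i - ψ) * expo l x)
      = expo l x * ((Real.exp (-A) - 1 + A) - (A + t * (∑ i, x i * φ i - ψ))) := by ring
  rw [hexp, hsplit, abs_mul, abs_of_pos (expo_pos l x)]
  calc expo l x * |Real.exp (-A) - 1 + A - (A + t * (∑ i, x i * φ i - ψ))|
      ≤ expo l x * (A ^ 2 * Real.exp |A| + (1 + S) * (ε * t)) :=
        mul_le_mul_of_nonneg_left ((abs_sub _ _).trans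
          (add_le_add (abs_exp_neg_sub_one_add_le A) hlin)) (expo_pos l x).le
    _ ≤ _ := by rw [mul_add, mul_add]; exact add_le_add hquad hline

/-! ### The action of a transition semigroup on bounded functions -/

/-- The operator `u ↦ P_t u`, that is, `(P_t u)(x) = ∫ u(y) P_t(x, dy)`. -/
noncomputable def act {S : Type*} [MeasurableSpace S] (P : ℝ≥0 → Kernel S S) (t : ℝ≥0)
    (u : S → ℝ) (x : S) : ℝ := ∫ y, u y ∂(P t x)

section act

variable {S : Type*} [MeasurableSpace S] {P : ℝ≥0 → Kernel S S}

theorem integrable_act (hP : IsTransitionSemigroup P) (t : ℝ≥0) {u : S → ℝ} (hu : Measurable u)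
    {M : ℝ} (hM : ∀ x, |u x| ≤ M) (x : S) : Integrable u (P t x) := by
  have := hP.markov t
  exact Integrable.of_bound hu.aestronglyMeasurable M (ae_of_all _ hM)

theorem abs_act_le (hP : IsTransitionSemigroup P) (t : ℝ≥0) {u : S → ℝ} {M : ℝ}
    (hM : ∀ x, |u x| ≤ M) (x : S) : |act P t u x| ≤ M := by
  have := hP.markov t
  have h := norm_integral_le_of_norm_le_const (μ := P t x) (f := u) (ae_of_all _ hM)
  simpa [act] using h

theorem act_act (hP : IsTransitionSemigroup P) (s t : ℝ≥0) {u : S → ℝ} (hu : Measurable u)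
    {M : ℝ} (hM : ∀ x, |u x| ≤ M) (x : S) : act P (s + t) u x = act P s (act P t u) x := by
  have h1 := hP.markov s
  have h2 := hP.markov t
  have h3 := hP.markov (s + t)
  have hi := integrable_act hP (s + t) hu hM x
  rw [hP.add] at hi
  rw [act, hP.add]
  exact Kernel.integral_comp hi

theorem act_linComb (hP : IsTransitionSemigroup P) (t : ℝ≥0) {u w : S → ℝ} (hu : Measurable u)
    (hw : Measurable w) {M N : ℝ} (hM : ∀ x, |u x| ≤ M) (hN : ∀ x, |w x| ≤ N) (a b : ℝ) (x : S) :
    act P t (fun y => a * u y + b * w y) x = a * act P t u x + b * act P t w x := by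
  rw [act, integral_add ((integrable_act hP t hu hM x).const_mul a)
    ((integrable_act hP t hw hN x).const_mul b), integral_const_mul, integral_const_mul]
  rfl

theorem measurable_act (P : ℝ≥0 → Kernel S S) (t : ℝ≥0) {u : S → ℝ} (hu : Measurable u) :
    Measurable (act P t u) :=
  (hu.stronglyMeasurable.integral_kernel (κ := P t)).measurable

end act
/-! ### The span of the decaying exponentials -/

/-- Exponents with strictly positive coordinates: their exponentials vanish at infinity. -/
abbrev PosVec (d : ℕ) : Type := {l : EuclideanSpace ℝ (Fin d) // ∀ i, 0 < l i}

namespace PosVec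

variable {d : ℕ}

theorem mem_orthant (l : PosVec d) : l.1 ∈ orthant d := fun i => (l.2 i).le

theorem exists_le (l : PosVec d) : ∃ δ > 0, ∀ i, δ ≤ l.1 i := by
  have h : ∀ᶠ δ in 𝓝[>] (0 : ℝ), ∀ i, δ ≤ l.1 i :=
    eventually_all.2 fun i => mem_nhdsWithin_of_mem_nhds (Iic_mem_nhds (l.2 i))
  obtain ⟨δ, h1, h2⟩ := (h.and self_mem_nhdsWithin).exists
  exact ⟨δ, h2, h1⟩

end PosVec

section graph

variable {d : ℕ}

theorem continuous_expo (l : EuclideanSpace ℝ (Fin d)) :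
    Continuous fun x : Orthant d => expo l x.1 :=
  (contDiff_expo l).continuous.comp continuous_subtype_val

/-- The exponential `e^{-⟨l, ·⟩}` as a bounded continuous function on the orthant. -/
noncomputable def expoBCF (l : PosVec d) : Orthant d →ᵇ ℝ :=
  BoundedContinuousFunction.ofNormedAddCommGroup (fun x => expo l.1 x.1) (continuous_expo l.1) 1
    fun x => by
      rw [Real.norm_of_nonneg (expo_pos _ _).le]
      exact expo_le_one l.mem_orthant x.2

theorem exists_affine_mul_expo_le (l : PosVec d) (φ : Fin d → ℝ) (ψ : ℝ) :
    ∃ C, ∀ x : Orthant d, |(∑ i, x.1 i * φ i - ψ) * expo l.1 x.1| ≤ C := by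
  obtain ⟨δ, hδ, hl⟩ := l.exists_le
  set K := ∑ i, |φ i| + |ψ| with hK
  have hK0 : 0 ≤ K := by positivity
  refine ⟨K * (1 + 2 / δ) ^ 2, fun x => ?_⟩
  set S := ∑ i, x.1 i with hS
  have hS0 : 0 ≤ S := Finset.sum_nonneg fun i _ => x.2 i
  have hφ : ∀ i, |φ i| ≤ ∑ i, |φ i| := fun i =>
    Finset.single_le_sum (f := fun i => |φ i|) (fun i _ => abs_nonneg _) (Finset.mem_univ i)
  have h1 : |∑ i, x.1 i * φ i - ψ| ≤ K * (1 + S) ^ 2 := by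
    have h2 : |∑ i, x.1 i * φ i| ≤ S * ∑ i, |φ i| := by
      rw [hS, Finset.sum_mul]
      refine (Finset.abs_sum_le_sum_abs _ _).trans (Finset.sum_le_sum fun i _ => ?_)
      rw [abs_mul, abs_of_nonneg (x.2 i)]
      exact mul_le_mul_of_nonneg_left (hφ i) (x.2 i)
    have h3 : 0 ≤ ∑ i, |φ i| := Finset.sum_nonneg fun i _ => abs_nonneg _
    have h4 : |∑ i, x.1 i * φ i - ψ| ≤ K * (1 + S) := by
      refine (abs_sub _ _).trans ?_
      nlinarith [mul_nonneg hS0 (abs_nonneg ψ)]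
    refine h4.trans (mul_le_mul_of_nonneg_left ?_ hK0)
    nlinarith
  have he := expo_le_exp hl x.2
  rw [abs_mul, abs_of_pos (expo_pos _ _)]
  calc |∑ i, x.1 i * φ i - ψ| * expo l.1 x.1
      ≤ (K * ((1 + 2 / δ) ^ 2 * Real.exp (δ * S))) * Real.exp (-(δ * S)) :=
        mul_le_mul (h1.trans (mul_le_mul_of_nonneg_left (one_add_sq_le_exp hδ hS0) hK0)) he
          (expo_pos _ _).le (by positivity)
    _ = K * (1 + 2 / δ) ^ 2 * (Real.exp (δ * S) * Real.exp (-(δ * S))) := by ring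
    _ = _ := by rw [← Real.exp_add, add_neg_cancel, Real.exp_zero, mul_one]

/-- The image of an exponential under the generator. -/
noncomputable def genExpoBCF (p : CBIParams d) (l : PosVec d) : Orthant d →ᵇ ℝ :=
  BoundedContinuousFunction.ofNormedAddCommGroup
    (fun x => (∑ i, x.1 i * p.phi i l.1 - p.psi l.1) * expo l.1 x.1)
    (Continuous.mul (by fun_prop) (continuous_expo l.1))
    (exists_affine_mul_expo_le l (fun i => p.phi i l.1) (p.psi l.1)).choose
    (exists_affine_mul_expo_le l (fun i => p.phi i l.1) (p.psi l.1)).choose_spec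

theorem genExpoBCF_apply (p : CBIParams d) (l : PosVec d) (x : Orthant d) :
    genExpoBCF p l x = (∑ i, x.1 i * p.phi i l.1 - p.psi l.1) * expo l.1 x.1 := rfl

theorem tendsto_expo_cocompact (l : PosVec d) :
    Tendsto (fun x : Orthant d => expo l.1 x.1) (cocompact (Orthant d)) (𝓝 0) := by
  obtain ⟨δ, hδ, hl⟩ := l.exists_le
  refine squeeze_zero (fun x => (expo_pos _ _).le) (fun x => ?_)
    (Real.tendsto_exp_neg_atTop_nhds_zero.comp ((tendsto_norm_cocompact_orthant d).const_mul_atTop hδ))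
  refine (expo_le_exp hl x.2).trans (Real.exp_le_exp.2 (neg_le_neg ?_))
  exact mul_le_mul_of_nonneg_left (norm_le_sum_coord x.2) hδ.le

/-- The graph of the generator restricted to the span of the decaying exponentials. -/
noncomputable def expoGraph (p : CBIParams d) :
    Submodule ℝ ((Orthant d →ᵇ ℝ) × (Orthant d →ᵇ ℝ)) :=
  Submodule.span ℝ (range fun l : PosVec d => (expoBCF l, genExpoBCF p l))

/-- Elements of the graph come from bounded `C²` functions vanishing at infinity and their
images under the generator. -/
theorem exists_isC2b_of_mem_expoGraph {p : CBIParams d} (hp : p.IsAdmissible)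
    {w : (Orthant d →ᵇ ℝ) × (Orthant d →ᵇ ℝ)} (hw : w ∈ expoGraph p) :
    ∃ F : EuclideanSpace ℝ (Fin d) → ℝ, IsC2b F ∧
      Tendsto (fun x : Orthant d => F x.1) (cocompact (Orthant d)) (𝓝 0) ∧
      ∀ x : Orthant d, F x.1 = w.1 x ∧ p.gen F x.1 = w.2 x := by
  have hlin : ∀ (w w' : (Orthant d →ᵇ ℝ) × (Orthant d →ᵇ ℝ)) (a b : ℝ),
      (∃ F : EuclideanSpace ℝ (Fin d) → ℝ, IsC2b F ∧
        Tendsto (fun x : Orthant d => F x.1) (cocompact (Orthant d)) (𝓝 0) ∧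
        ∀ x : Orthant d, F x.1 = w.1 x ∧ p.gen F x.1 = w.2 x) →
      (∃ F : EuclideanSpace ℝ (Fin d) → ℝ, IsC2b F ∧
        Tendsto (fun x : Orthant d => F x.1) (cocompact (Orthant d)) (𝓝 0) ∧
        ∀ x : Orthant d, F x.1 = w'.1 x ∧ p.gen F x.1 = w'.2 x) →
      ∃ F : EuclideanSpace ℝ (Fin d) → ℝ, IsC2b F ∧
        Tendsto (fun x : Orthant d => F x.1) (cocompact (Orthant d)) (𝓝 0) ∧
        ∀ x : Orthant d, F x.1 = (a • w + b • w').1 x ∧ p.gen F x.1 = (a • w + b • w').2 x := by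
    rintro w w' a b ⟨F, hF, hF0, hFw⟩ ⟨G, hG, hG0, hGw⟩
    refine ⟨fun x => a * F x + b * G x, hF.linComb hG a b, ?_, fun x => ⟨?_, ?_⟩⟩
    · simpa using (hF0.const_mul a).add (hG0.const_mul b)
    · simp [(hFw x).1, (hGw x).1]
    · rw [hF.gen_linComb hG hp a b x.2]
      simp [(hFw x).2, (hGw x).2]
  have hmem : ∀ l : PosVec d, ∃ F : EuclideanSpace ℝ (Fin d) → ℝ, IsC2b F ∧
      Tendsto (fun x : Orthant d => F x.1) (cocompact (Orthant d)) (𝓝 0) ∧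
      ∀ x : Orthant d, F x.1 = expoBCF l x ∧ p.gen F x.1 = genExpoBCF p l x := fun l =>
    ⟨expo l.1, isC2b_expo l.mem_orthant, tendsto_expo_cocompact l, fun x =>
      ⟨rfl, gen_expo p l.1 x.2⟩⟩
  induction hw using Submodule.span_induction with
  | mem w h =>
    obtain ⟨l, rfl⟩ := h
    exact hmem l
  | zero =>
    have l : PosVec d := ⟨WithLp.toLp 2 fun _ => 1, fun i => one_pos⟩
    simpa using hlin (expoBCF l, genExpoBCF p l) (expoBCF l, genExpoBCF p l) 0 0 (hmem l) (hmem l)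
  | add w w' _ _ h h' => simpa using hlin w w' 1 1 h h'
  | smul a w _ h => simpa using hlin w w a 0 h h

end graph

/-! ### The transition semigroup on the span of the decaying exponentials -/

/-- The formula for the Laplace transforms of the transition kernels `P`. -/
def CBIParams.HasLaplace {d : ℕ} (p : CBIParams d) (P : ℝ≥0 → Kernel (Orthant d) (Orthant d)) :
    Prop :=
  ∀ l : Orthant d, ∃ v : ℝ → EuclideanSpace ℝ (Fin d), p.IsCumulant l.1 v ∧
    ∀ (t : ℝ≥0) (x : Orthant d), ∫ y : Orthant d, Real.exp (-∑ j, l.1 j * y.1 j) ∂(P t x)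
      = Real.exp (-∑ j, x.1 j * v t j - ∫ s in (0 : ℝ)..t, p.psi (v s))

section semigroup

variable {d : ℕ} {p : CBIParams d} {P : ℝ≥0 → Kernel (Orthant d) (Orthant d)}

theorem exists_abs_sub_le_of_hasDerivWithinAt {f : ℝ → ℝ} {f' : ℝ}
    (h : HasDerivWithinAt f f' (Ici 0) 0) {ε : ℝ} (hε : 0 < ε) :
    ∀ᶠ t in 𝓝[≥] (0 : ℝ), |f t - f 0 - t * f'| ≤ ε * t := by
  have h1 := (hasDerivWithinAt_iff_isLittleO.1 h).def hε
  filter_upwards [h1, self_mem_nhdsWithin] with t ht ht0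
  simpa [abs_of_nonneg (show (0 : ℝ) ≤ t from ht0)] using ht

theorem CBIParams.IsCumulant.hasDerivWithinAt_psi (hp : p.IsAdmissible)
    {l : EuclideanSpace ℝ (Fin d)} {v : ℝ → EuclideanSpace ℝ (Fin d)} (hv : p.IsCumulant l v) :
    HasDerivWithinAt (fun t => ∫ s in (0 : ℝ)..t, p.psi (v s)) (p.psi l) (Ici 0) 0 := by
  have hc : ContinuousOn (fun s => p.psi (v s)) (Ici 0) :=
    hp.continuousOn_psi.comp hv.smooth.continuousOn fun s hs => hv.mem_orthant s hs
  have h := intervalIntegral.integral_hasDerivWithinAt_right (a := (0 : ℝ)) (b := 0)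
    (f := fun s => p.psi (v s)) (s := Ici 0) (t := Ioi 0) (by simp)
    ((hc.mono Ioi_subset_Ici_self).stronglyMeasurableAtFilter_nhdsWithin measurableSet_Ioi 0)
    ((hc 0 self_mem_Ici).mono Ioi_subset_Ici_self)
  simpa only [hv.initial] using h

/-- For exponentials, `P_t u - u - t · gen u = o(t)` uniformly over the orthant. -/
theorem expo_expansion (hp : p.IsAdmissible) (hL : p.HasLaplace P) (l : PosVec d) {ε : ℝ}
    (hε : 0 < ε) : ∃ δ > 0, ∀ t : ℝ≥0, (t : ℝ) ≤ δ → ∀ x : Orthant d,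
      |act P t (expoBCF l) x - expoBCF l x - t * genExpoBCF p l x| ≤ ε * t := by
  obtain ⟨v, hv, hlap⟩ := hL ⟨l.1, l.mem_orthant⟩
  obtain ⟨η', hη', hl'⟩ := l.exists_le
  set η := η' / 2 with hη
  have hη0 : 0 < η := by positivity
  set C := 1 + ∑ i, |p.phi i l.1| + |p.psi l.1| with hC
  have hC0 : 0 < C := by positivity
  set L := (1 + 2 / η) ^ 2 * Real.exp η with hLdef
  have hL0 : 0 < L := by positivity
  set ε' := min 1 (ε / (2 * L)) with hε'
  have hε'0 : 0 < ε' := lt_min one_pos (by positivity)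
  have h1 : ∀ᶠ t in 𝓝[≥] (0 : ℝ), ∀ i, |v t i - l.1 i + t * p.phi i l.1| ≤ ε' * t := by
    refine eventually_all.2 fun i => ?_
    have := hv.hasDerivWithinAt_coord le_rfl i
    rw [hv.initial] at this
    filter_upwards [exists_abs_sub_le_of_hasDerivWithinAt this hε'0] with t ht
    simpa [hv.initial] using ht
  have h2 : ∀ᶠ t in 𝓝[≥] (0 : ℝ),
      |(∫ s in (0 : ℝ)..t, p.psi (v s)) - t * p.psi l.1| ≤ ε' * t := by
    filter_upwards [exists_abs_sub_le_of_hasDerivWithinAt (hv.hasDerivWithinAt_psi hp) hε'0]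
      with t ht
    simpa using ht
  have h3 : ∀ᶠ t in 𝓝[≥] (0 : ℝ), C * t ≤ η ∧ L * C ^ 2 * t ≤ ε / 2 := by
    refine mem_nhdsWithin_of_mem_nhds (Eventually.and ?_ ?_)
    · exact ((continuous_const.mul continuous_id).tendsto' (0 : ℝ) 0 (by simp)).eventually_le_const
        hη0
    · exact ((continuous_const.mul continuous_id).tendsto' (0 : ℝ) 0 (by simp)).eventually_le_const
        (by positivity)
  obtain ⟨r, hr, hr'⟩ := Metric.eventually_nhds_iff.1
    (eventually_nhdsWithin_iff.1 ((h1.and h2).and h3))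
  refine ⟨r / 2, by positivity, fun t ht x => ?_⟩
  have ht0 : (0 : ℝ) ≤ t := t.2
  obtain ⟨⟨hA, hB⟩, hCt, hCt2⟩ := hr' (y := (t : ℝ))
    (by rw [Real.dist_eq, sub_zero, abs_of_nonneg ht0]; linarith) ht0
  have hmain := abs_exp_sub_expo_le hη0 (fun i => by rw [hη]; linarith [hl' i]) x.2 ht0
    hε'0.le (min_le_left _ _) hC hCt hA hB
  have hact : act P t (expoBCF l) x
      = Real.exp (-∑ j, x.1 j * v t j - ∫ s in (0 : ℝ)..t, p.psi (v s)) := hlap t x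
  rw [hact, genExpoBCF_apply]
  refine hmain.trans ?_
  have h4 : L * ε' ≤ ε / 2 := by
    calc L * ε' ≤ L * (ε / (2 * L)) := mul_le_mul_of_nonneg_left (min_le_right _ _) hL0.le
      _ = ε / 2 := by field_simp
  calc L * (C ^ 2 * (t : ℝ) ^ 2 + ε' * t) = (L * C ^ 2 * t + L * ε') * t := by ring
    _ ≤ _ := mul_le_mul_of_nonneg_right (by linarith) ht0

theorem measurable_bcf (u : Orthant d →ᵇ ℝ) : Measurable u := u.continuous.measurable

theorem abs_bcf_le (u : Orthant d →ᵇ ℝ) (x : Orthant d) : |u x| ≤ ‖u‖ := u.norm_coe_le_norm x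

theorem act_linComb_bcf (hP : IsTransitionSemigroup P) (t : ℝ≥0) (u w : Orthant d →ᵇ ℝ)
    (a b : ℝ) (x : Orthant d) :
    act P t (fun y => a * u y + b * w y) x = a * act P t u x + b * act P t w x :=
  act_linComb hP t (measurable_bcf u) (measurable_bcf w) (abs_bcf_le u) (abs_bcf_le w) a b x

theorem expansion_of_mem_expoGraph (hp : p.IsAdmissible) (hP : IsTransitionSemigroup P)
    (hL : p.HasLaplace P) {w : (Orthant d →ᵇ ℝ) × (Orthant d →ᵇ ℝ)} (hw : w ∈ expoGraph p) :
    ∀ ε > 0, ∃ δ > 0, ∀ t : ℝ≥0, (t : ℝ) ≤ δ → ∀ x : Orthant d,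
      |act P t w.1 x - w.1 x - t * w.2 x| ≤ ε * t := by
  induction hw using Submodule.span_induction with
  | mem w h =>
    obtain ⟨l, rfl⟩ := h
    exact fun ε hε => expo_expansion hp hL l hε
  | zero =>
    refine fun ε hε => ⟨1, one_pos, fun t _ x => ?_⟩
    have e : act P t (0 : (Orthant d →ᵇ ℝ) × (Orthant d →ᵇ ℝ)).1 x
        - (0 : (Orthant d →ᵇ ℝ) × (Orthant d →ᵇ ℝ)).1 x
        - t * (0 : (Orthant d →ᵇ ℝ) × (Orthant d →ᵇ ℝ)).2 x = 0 := by simp [act]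
    rw [e, abs_zero]
    exact mul_nonneg hε.le t.2
  | add w w' _ _ h h' =>
    intro ε hε
    obtain ⟨δ, hδ, H⟩ := h (ε / 2) (by positivity)
    obtain ⟨δ', hδ', H'⟩ := h' (ε / 2) (by positivity)
    refine ⟨min δ δ', lt_min hδ hδ', fun t ht x => ?_⟩
    have e := act_linComb_bcf hP t w.1 w'.1 1 1 x
    simp only [one_mul] at e
    have e' : act P t (w + w').1 x = act P t w.1 x + act P t w'.1 x := e
    rw [e']
    have h1 := abs_le.1 (H t (ht.trans (min_le_left _ _)) x)
    have h2 := abs_le.1 (H' t (ht.trans (min_le_right _ _)) x)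
    simp only [Prod.fst_add, Prod.snd_add, BoundedContinuousFunction.add_apply]
    exact abs_le.2 ⟨by linarith, by linarith⟩
  | smul a w _ h =>
    intro ε hε
    obtain ⟨δ, hδ, H⟩ := h (ε / (|a| + 1)) (by positivity)
    refine ⟨δ, hδ, fun t ht x => ?_⟩
    have e := act_linComb_bcf hP t w.1 w.1 a 0 x
    simp only [zero_mul, add_zero] at e
    have e' : act P t (a • w).1 x = a * act P t w.1 x := e
    have e2 : act P t (a • w).1 x - (a • w).1 x - t * (a • w).2 x
        = a * (act P t w.1 x - w.1 x - t * w.2 x) := by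
      rw [e']
      simp only [Prod.smul_fst, Prod.smul_snd, BoundedContinuousFunction.coe_smul, smul_eq_mul]
      ring
    rw [e2, abs_mul]
    have ht0 : (0 : ℝ) ≤ t := t.2
    calc |a| * |act P t w.1 x - w.1 x - t * w.2 x|
        ≤ (|a| + 1) * (ε / (|a| + 1) * t) :=
          mul_le_mul (by linarith) (H t ht x) (abs_nonneg _) (by positivity)
      _ = ε * t := by field_simp

theorem abs_act_expansion_le (hP : IsTransitionSemigroup P) (h t : ℝ≥0)
    {w : (Orthant d →ᵇ ℝ) × (Orthant d →ᵇ ℝ)} {η : ℝ}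
    (H : ∀ y, |act P h w.1 y - w.1 y - h * w.2 y| ≤ η) (x : Orthant d) :
    |act P t (act P h w.1) x - act P t w.1 x - h * act P t w.2 x| ≤ η := by
  have i1 := integrable_act hP t (measurable_act P h (measurable_bcf w.1))
    (abs_act_le hP h (abs_bcf_le w.1)) x
  have i2 := integrable_act hP t (measurable_bcf w.1) (abs_bcf_le w.1) x
  have i3 := (integrable_act hP t (measurable_bcf w.2) (abs_bcf_le w.2) x).const_mul (h : ℝ)
  have e : act P t (fun y => act P h w.1 y - w.1 y - h * w.2 y) x
      = act P t (act P h w.1) x - act P t w.1 x - h * act P t w.2 x := by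
    have e1 := integral_sub (i1.sub i2) i3
    have e2 := integral_sub i1 i2
    have e3 := integral_const_mul (μ := P t x) (h : ℝ) w.2
    simp only [Pi.sub_apply] at e1
    rw [act, e1, e2, e3]
    rfl
  rw [← e]
  exact abs_act_le hP t H x

/-- The span of the decaying exponentials is invariant under the semigroup, which commutes with
the generator there. -/
theorem exists_act_mem_expoGraph (hp : p.IsAdmissible) (hP : IsTransitionSemigroup P)
    (hL : p.HasLaplace P) {w : (Orthant d →ᵇ ℝ) × (Orthant d →ᵇ ℝ)} (hw : w ∈ expoGraph p)
    (t : ℝ≥0) : ∃ w' ∈ expoGraph p, ∀ x, w'.1 x = act P t w.1 x ∧ w'.2 x = act P t w.2 x := by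
  have key : ∃ w' ∈ expoGraph p, ∀ x, w'.1 x = act P t w.1 x := by
    induction hw using Submodule.span_induction with
    | mem w h =>
      obtain ⟨l, rfl⟩ := h
      obtain ⟨v, hv, hlap⟩ := hL ⟨l.1, l.mem_orthant⟩
      set a := ∫ s in (0 : ℝ)..t, p.psi (v s) with ha
      let l' : PosVec d := ⟨v t, fun i => hp.cumulant_pos hv (l.2 i) t.2⟩
      refine ⟨Real.exp (-a) • (expoBCF l', genExpoBCF p l'),
        Submodule.smul_mem _ _ (Submodule.subset_span ⟨l', rfl⟩), fun x => ?_⟩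
      have h1 : act P t (expoBCF l) x = Real.exp (-∑ j, x.1 j * v t j - a) := hlap t x
      change Real.exp (-a) * Real.exp (-∑ j, v t j * x.1 j) = act P t (expoBCF l) x
      rw [h1, ← Real.exp_add, Finset.sum_congr rfl fun j _ => mul_comm (v t j) (x.1 j)]
      congr 1
      ring
    | zero => exact ⟨0, Submodule.zero_mem _, fun x => by simp [act]⟩
    | add w₁ w₂ _ _ h₁ h₂ =>
      obtain ⟨w₁', hm₁, e₁⟩ := h₁
      obtain ⟨w₂', hm₂, e₂⟩ := h₂
      refine ⟨w₁' + w₂', Submodule.add_mem _ hm₁ hm₂, fun x => ?_⟩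
      have e := act_linComb_bcf hP t w₁.1 w₂.1 1 1 x
      simp only [one_mul] at e
      change w₁'.1 x + w₂'.1 x = _
      rw [e₁, e₂]
      exact e.symm
    | smul a w₁ _ h₁ =>
      obtain ⟨w₁', hm₁, e₁⟩ := h₁
      refine ⟨a • w₁', Submodule.smul_mem _ _ hm₁, fun x => ?_⟩
      have e := act_linComb_bcf hP t w₁.1 w₁.1 a 0 x
      simp only [zero_mul, add_zero] at e
      change a * w₁'.1 x = _
      rw [e₁]
      exact e.symm
  obtain ⟨w', hw', e⟩ := key
  refine ⟨w', hw', fun x => ⟨e x, ?_⟩⟩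
  -- both sides are the derivative at `0` of `h ↦ P_{h + t} u (x) = P_h (P_t u) (x)`
  refine eq_of_abs_sub_le_all fun ε hε => ?_
  obtain ⟨δ, hδ, H⟩ := expansion_of_mem_expoGraph hp hP hL hw (ε / 2) (by positivity)
  obtain ⟨δ', hδ', H'⟩ := expansion_of_mem_expoGraph hp hP hL hw' (ε / 2) (by positivity)
  set h : ℝ≥0 := (min δ δ').toNNReal with hh
  have hpos : (0 : ℝ) < h := by
    rw [hh, Real.coe_toNNReal _ (lt_min hδ hδ').le]; exact lt_min hδ hδ'
  have hle : (h : ℝ) = min δ δ' := Real.coe_toNNReal _ (lt_min hδ hδ').le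
  have h1 := H' h (hle.le.trans (min_le_right _ _)) x
  have hw'fun : (w'.1 : Orthant d → ℝ) = act P t w.1 := funext e
  have hcomm : act P h w'.1 x = act P t (act P h w.1) x := by
    rw [hw'fun, ← act_act hP h t (measurable_bcf w.1) (abs_bcf_le w.1),
      ← act_act hP t h (measurable_bcf w.1) (abs_bcf_le w.1), add_comm]
  have h2 := abs_act_expansion_le hP h t (H h (hle.le.trans (min_le_left _ _))) x
  rw [← hcomm, ← e x] at h2
  have h3 := abs_le.1 h1
  have h4 := abs_le.1 h2
  have h5 : |(h : ℝ) * (w'.2 x - act P t w.2 x)| ≤ h * ε := abs_le.2 ⟨by linarith, by linarith⟩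
  rw [abs_mul, abs_of_pos hpos] at h5
  exact le_of_mul_le_mul_left h5 hpos

end semigroup
/-! ### Density of the exponentials and of the range of `1 - gen` -/

section density

variable {d : ℕ} {p : CBIParams d} {P : ℝ≥0 → Kernel (Orthant d) (Orthant d)}

theorem expoBCF_mul (l m : PosVec d) :
    expoBCF l * expoBCF m = expoBCF ⟨l.1 + m.1, fun i => add_pos (l.2 i) (m.2 i)⟩ := by
  ext x
  exact (expo_add_left l.1 m.1 x.1).symm

theorem mul_mem_span_expoBCF {u w : Orthant d →ᵇ ℝ}
    (hu : u ∈ Submodule.span ℝ (range (expoBCF (d := d))))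
    (hw : w ∈ Submodule.span ℝ (range (expoBCF (d := d)))) :
    u * w ∈ Submodule.span ℝ (range (expoBCF (d := d))) := by
  have h := Submodule.mul_mem_mul hu hw
  rw [Submodule.span_mul_span] at h
  refine Submodule.span_mono ?_ h
  rintro _ ⟨_, ⟨l, rfl⟩, _, ⟨m, rfl⟩, rfl⟩
  exact ⟨_, (expoBCF_mul l m).symm⟩

theorem exists_mem_expoGraph_fst {u : Orthant d →ᵇ ℝ} (p : CBIParams d)
    (hu : u ∈ Submodule.span ℝ (range (expoBCF (d := d)))) : ∃ w ∈ expoGraph p, w.1 = u := by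
  have h : Submodule.span ℝ (range (expoBCF (d := d)))
      = (expoGraph p).map (LinearMap.fst ℝ (Orthant d →ᵇ ℝ) (Orthant d →ᵇ ℝ)) := by
    rw [expoGraph, Submodule.map_span, ← range_comp]
    rfl
  rw [h] at hu
  obtain ⟨w, hw, rfl⟩ := hu
  exact ⟨w, hw, rfl⟩

/-- The exponential `e^{-⟨l, ·⟩}` on the one point compactification, with value `0` at `∞`. -/
noncomputable def expoOnePoint (l : PosVec d) : C(OnePoint (Orthant d), ℝ) :=
  OnePoint.continuousMapMk (expoBCF l).toContinuousMap 0 (by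
    rw [coclosedCompact_eq_cocompact]
    exact tendsto_expo_cocompact l)

theorem expoOnePoint_coe (l : PosVec d) (x : Orthant d) :
    expoOnePoint l (x : OnePoint (Orthant d)) = expo l.1 x.1 := rfl

theorem expoOnePoint_infty (l : PosVec d) : expoOnePoint l OnePoint.infty = 0 := rfl

theorem separatesPoints_expoOnePoint :
    (Algebra.adjoin ℝ (range (expoOnePoint (d := d)))).SeparatesPoints := by
  have hmem : ∀ l : PosVec d, expoOnePoint l ∈ Algebra.adjoin ℝ (range (expoOnePoint (d := d))) :=
    fun l => Algebra.subset_adjoin ⟨l, rfl⟩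
  let one : PosVec d := ⟨WithLp.toLp 2 fun _ => 1, fun i => one_pos⟩
  suffices h : ∀ x y : OnePoint (Orthant d), (∀ l, expoOnePoint l x = expoOnePoint l y) → x = y by
    intro x y hxy
    by_contra hne
    refine hxy (h x y fun l => ?_)
    by_contra hl
    exact hne ⟨_, ⟨_, hmem l, rfl⟩, hl⟩
  intro x y h
  induction x using OnePoint.rec with
  | infty =>
    induction y using OnePoint.rec with
    | infty => rfl
    | coe y =>
      have := h one
      rw [expoOnePoint_infty, expoOnePoint_coe] at this
      exact absurd this (expo_pos _ _).ne
  | coe x =>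
    induction y using OnePoint.rec with
    | infty =>
      have := h one
      rw [expoOnePoint_infty, expoOnePoint_coe] at this
      exact absurd this (expo_pos _ _).ne'
    | coe y =>
      -- comparing the exponents `(1, …, 1)` and `(1, …, 1) + e_i` gives the `i`-th coordinate
      have hsum : ∀ l : PosVec d, ∑ j, l.1 j * x.1 j = ∑ j, l.1 j * y.1 j := fun l =>
        neg_injective (Real.exp_injective (h l))
      congr 1
      refine Subtype.ext ?_
      ext i
      have h1 := hsum one
      have h2 := hsum ⟨WithLp.toLp 2 fun j => 1 + if j = i then 1 else 0, fun j => by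
        change (0 : ℝ) < 1 + if j = i then 1 else 0
        split_ifs <;> norm_num⟩
      simp only [add_mul, Finset.sum_add_distrib, ite_mul, one_mul, zero_mul,
        Finset.sum_ite_eq', Finset.mem_univ, if_true] at h2
      simp only [one, one_mul] at h1
      linarith

/-- Stone–Weierstrass: the decaying exponentials span a dense subspace of the continuous
functions vanishing at infinity. -/
theorem exists_expoGraph_fst_near (p : CBIParams d) {g : Orthant d →ᵇ ℝ} {R : ℝ}
    (hg : ∀ x : Orthant d, R < ‖x.1‖ → g x = 0) {ε : ℝ} (hε : 0 < ε) :
    ∃ w ∈ expoGraph p, ∀ x, |w.1 x - g x| ≤ ε := by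
  have h0 : Tendsto g (cocompact (Orthant d)) (𝓝 0) := by
    refine tendsto_const_nhds.congr' ?_
    filter_upwards [(tendsto_norm_cocompact_orthant d).eventually_gt_atTop R] with x hx using (hg x hx).symm
  let g' : C(OnePoint (Orthant d), ℝ) := OnePoint.continuousMapMk g.toContinuousMap 0 (by
    rw [coclosedCompact_eq_cocompact]
    exact h0)
  obtain ⟨⟨a, ha⟩, hag⟩ :=
    ContinuousMap.exists_mem_subalgebra_near_continuousMap_of_separatesPoints _
      separatesPoints_expoOnePoint g' (ε / 2) (by positivity)
  have hform : ∃ c : ℝ, ∃ u ∈ Submodule.span ℝ (range (expoBCF (d := d))),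
      a OnePoint.infty = c ∧ ∀ x : Orthant d, a (x : OnePoint (Orthant d)) = c + u x := by
    clear hag
    induction ha using Algebra.adjoin_induction with
    | mem a h =>
      obtain ⟨l, rfl⟩ := h
      exact ⟨0, expoBCF l, Submodule.subset_span ⟨l, rfl⟩, rfl, fun x => (zero_add _).symm⟩
    | algebraMap r => exact ⟨r, 0, Submodule.zero_mem _, rfl, fun x => (add_zero _).symm⟩
    | add a b _ _ ha hb =>
      obtain ⟨c, u, hu, h1, h2⟩ := ha
      obtain ⟨c', u', hu', h1', h2'⟩ := hb
      refine ⟨c + c', u + u', Submodule.add_mem _ hu hu', ?_, fun x => ?_⟩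
      · rw [ContinuousMap.add_apply, h1, h1']
      · rw [ContinuousMap.add_apply, h2, h2', BoundedContinuousFunction.add_apply]
        ring
    | mul a b _ _ ha hb =>
      obtain ⟨c, u, hu, h1, h2⟩ := ha
      obtain ⟨c', u', hu', h1', h2'⟩ := hb
      refine ⟨c * c', c • u' + c' • u + u * u', Submodule.add_mem _ (Submodule.add_mem _
        (Submodule.smul_mem _ _ hu') (Submodule.smul_mem _ _ hu)) (mul_mem_span_expoBCF hu hu'),
        ?_, fun x => ?_⟩
      · rw [ContinuousMap.mul_apply, h1, h1']
      · rw [ContinuousMap.mul_apply, h2, h2']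
        simp only [BoundedContinuousFunction.coe_add, BoundedContinuousFunction.coe_smul,
          BoundedContinuousFunction.coe_mul, Pi.add_apply, Pi.mul_apply, smul_eq_mul]
        ring
  obtain ⟨c, u, hu, hc, hx⟩ := hform
  obtain ⟨w, hw, rfl⟩ := exists_mem_expoGraph_fst p hu
  have hnear : ∀ y, |a y - g' y| ≤ ε / 2 := fun y =>
    ((a - g').norm_coe_le_norm y).trans hag.le
  have hc' : |c| ≤ ε / 2 := by
    have := hnear OnePoint.infty
    rw [hc] at this
    have h1 : g' OnePoint.infty = 0 := rfl
    rwa [h1, sub_zero] at this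
  refine ⟨w, hw, fun x => ?_⟩
  have h1 := hnear (x : OnePoint (Orthant d))
  rw [hx] at h1
  have h2 : |c + w.1 x - g x| ≤ ε / 2 := h1
  have h3 := abs_le.1 hc'
  have h4 := abs_le.1 h2
  exact abs_le.2 ⟨by linarith, by linarith⟩

/-- An invariant space of functions lies in the closure of its own image under `1 - gen`: if
`a(t)` is the distance of `P_t u` from that image, then `(1 + h) a(t) ≤ a(t + h) + o(h)` uniformly
in `t`, and `a` is bounded, which forces it to vanish. -/
theorem exists_expoGraph_sub_near_fst (hp : p.IsAdmissible) (hP : IsTransitionSemigroup P)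
    (hL : p.HasLaplace P) {w : (Orthant d →ᵇ ℝ) × (Orthant d →ᵇ ℝ)} (hw : w ∈ expoGraph p)
    {ε : ℝ} (hε : 0 < ε) : ∃ w' ∈ expoGraph p, ∀ x, |w'.1 x - w'.2 x - w.1 x| ≤ ε := by
  set G : Submodule ℝ (Orthant d →ᵇ ℝ) := (expoGraph p).map
    (LinearMap.fst ℝ (Orthant d →ᵇ ℝ) (Orthant d →ᵇ ℝ)
      - LinearMap.snd ℝ (Orthant d →ᵇ ℝ) (Orthant d →ᵇ ℝ)) with hG
  choose F hFm hF using fun t => exists_act_mem_expoGraph hp hP hL hw t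
  have hF0 : (F 0).1 = w.1 := by
    ext x
    rw [(hF 0 x).1, act, hP.zero, Kernel.id_apply, integral_dirac]
  set a : ℝ≥0 → ℝ := fun t => Metric.infDist (F t).1 (G : Set (Orthant d →ᵇ ℝ)) with ha
  have hab : ∀ t, a t ≤ ‖w.1‖ := fun t => by
    refine (Metric.infDist_le_dist_of_mem G.zero_mem).trans ?_
    rw [dist_zero_right]
    refine (BoundedContinuousFunction.norm_le (norm_nonneg _)).2 fun x => ?_
    rw [(hF t x).1]
    exact abs_act_le hP t (abs_bcf_le w.1) x
  have hbdd : BddAbove (range a) := ⟨‖w.1‖, by rintro _ ⟨t, rfl⟩; exact hab t⟩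
  have hzero : a 0 ≤ 0 := by
    refine le_of_forall_pos_le_add fun η hη => ?_
    obtain ⟨δ, hδ, H⟩ := expansion_of_mem_expoGraph hp hP hL hw η hη
    set h : ℝ≥0 := δ.toNNReal with hh
    have hhδ : (h : ℝ) = δ := Real.coe_toNNReal _ hδ.le
    have hstep : ∀ t, (1 + δ) * a t ≤ (⨆ t, a t) + η * δ := fun t => by
      set r : Orthant d →ᵇ ℝ := (F (t + h)).1 - (F t).1 - δ • (F t).2 with hr
      have hrn : ‖r‖ ≤ η * δ := by
        refine (BoundedContinuousFunction.norm_le (by positivity)).2 fun x => ?_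
        have h1 := abs_act_expansion_le hP h t (H h hhδ.le) x
        rw [hhδ, ← act_act hP t h (measurable_bcf w.1) (abs_bcf_le w.1), ← (hF _ x).1,
          ← (hF _ x).1, ← (hF _ x).2] at h1
        exact h1
      have hz : (F t).1 - (F t).2 ∈ G := ⟨F t, hFm t, rfl⟩
      have h2 : (1 + δ) * a t - η * δ ≤ a (t + h) := by
        refine (Metric.le_infDist ⟨0, G.zero_mem⟩).2 fun y hy => ?_
        have hmem : (1 + δ)⁻¹ • (y + δ • ((F t).1 - (F t).2)) ∈ G :=
          G.smul_mem _ (G.add_mem hy (G.smul_mem _ hz))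
        have h3 : (1 + δ) * a t ≤ ‖(1 + δ) • (F t).1 - (y + δ • ((F t).1 - (F t).2))‖ := by
          have h4 := Metric.infDist_le_dist_of_mem (x := (F t).1) hmem
          have h5 : (1 + δ) • (F t).1 - (y + δ • ((F t).1 - (F t).2))
              = (1 + δ) • ((F t).1 - (1 + δ)⁻¹ • (y + δ • ((F t).1 - (F t).2))) := by
            rw [smul_sub (1 + δ), smul_inv_smul₀ (by positivity)]
          rw [h5, norm_smul, Real.norm_of_nonneg (by positivity), ← dist_eq_norm]
          exact mul_le_mul_of_nonneg_left h4 (by positivity)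
        have h6 : (1 + δ) • (F t).1 - (y + δ • ((F t).1 - (F t).2)) = ((F (t + h)).1 - y) - r := by
          rw [hr, add_smul, one_smul, smul_sub]; abel
        rw [h6] at h3
        rw [dist_eq_norm]
        linarith [norm_sub_le ((F (t + h)).1 - y) r]
      linarith [le_ciSup hbdd (t + h)]
    have hsup : (⨆ t, a t) ≤ ((⨆ t, a t) + η * δ) / (1 + δ) := ciSup_le fun t => by
      rw [le_div_iff₀ (by linarith), mul_comm]; exact hstep t
    rw [le_div_iff₀ (by linarith)] at hsup
    have h3 : (⨆ t, a t) ≤ η := by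
      refine le_of_mul_le_mul_right ?_ hδ
      linarith
    rw [zero_add]
    exact (le_ciSup hbdd 0).trans h3
  have hcl : w.1 ∈ closure (G : Set (Orthant d →ᵇ ℝ)) := by
    rw [← hF0]
    exact (Metric.mem_closure_iff_infDist_zero ⟨0, G.zero_mem⟩).2
      (le_antisymm hzero Metric.infDist_nonneg)
  obtain ⟨_, ⟨w', hw', rfl⟩, hdist⟩ := Metric.mem_closure_iff.1 hcl ε hε
  refine ⟨w', hw', fun x => ?_⟩
  rw [dist_comm, dist_eq_norm] at hdist
  exact (BoundedContinuousFunction.norm_coe_le_norm _ x).trans hdist.le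

/-- The span of the decaying exponentials approximates every `f ∈ C²_c` in the graph norm of the
generator: `f - gen f` is approximated by density, and dissipativity controls the difference. -/
theorem exists_expoGraph_near (hp : p.IsAdmissible) (hP : IsTransitionSemigroup P)
    (hL : p.HasLaplace P) {f : EuclideanSpace ℝ (Fin d) → ℝ} (hf : IsC2c f)
    {fB gB : Orthant d →ᵇ ℝ} (hfB : ∀ x : Orthant d, fB x = f x.1)
    (hgB : ∀ x : Orthant d, gB x = p.gen f x.1) {ε : ℝ} (hε : 0 < ε) :
    ∃ w ∈ expoGraph p, ∀ x, |w.1 x - fB x| ≤ ε ∧ |w.2 x - gB x| ≤ ε := by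
  obtain ⟨R, hR⟩ := hf.exists_gen_eq_zero p
  obtain ⟨w₀, hw₀, h₀⟩ := exists_expoGraph_fst_near p (g := fB - gB) (R := R) (fun x hx => by
    rw [BoundedContinuousFunction.coe_sub, Pi.sub_apply, hfB, hgB, (hR x.1 x.2 hx).1,
      (hR x.1 x.2 hx).2, sub_zero]) (ε := ε / 4) (by positivity)
  obtain ⟨w, hw, h⟩ := exists_expoGraph_sub_near_fst hp hP hL hw₀ (ε := ε / 4) (by positivity)
  obtain ⟨F, hF, hF0, hFw⟩ := exists_isC2b_of_mem_expoGraph hp hw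
  have hres : ∀ x : Orthant d, |(w.1 x - w.2 x) - (fB x - gB x)| ≤ ε / 2 := fun x => by
    have h1 := abs_le.1 (h x)
    have h2 := abs_le.1 (h₀ x)
    rw [BoundedContinuousFunction.coe_sub, Pi.sub_apply] at h2
    exact abs_le.2 ⟨by linarith, by linarith⟩
  have hf0 : Tendsto (fun x : Orthant d => f x.1) (cocompact (Orthant d)) (𝓝 0) := by
    refine tendsto_const_nhds.congr' ?_
    filter_upwards [(tendsto_norm_cocompact_orthant d).eventually_gt_atTop R] with x hx using (hR x.1 x.2 hx).1.symm
  have hdiff : ∀ x : Orthant d, |w.1 x - fB x| ≤ ε / 2 := fun x => by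
    have hgen : ∀ y ∈ orthant d, p.gen (fun y => 1 * F y + (-1) * f y) y
        = p.gen F y - p.gen f y := fun y hy => by
      rw [hF.gen_linComb hf.isC2b hp 1 (-1) hy]; ring
    have := (hF.linComb hf.isC2b 1 (-1)).abs_le_of_abs_sub_gen_le hp
      (by simpa [sub_eq_add_neg] using (hF0.sub hf0)) (ε := ε / 2) (fun y hy => by
        rw [hgen y hy]
        have h1 := hres ⟨y, hy⟩
        rw [← (hFw ⟨y, hy⟩).1, ← (hFw ⟨y, hy⟩).2, hfB, hgB] at h1
        convert h1 using 2
        ring) x.2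
    rw [← (hFw x).1, hfB]
    convert this using 2
    ring
  refine ⟨w, hw, fun x => ⟨(hdiff x).trans (by linarith), ?_⟩⟩
  have h1 := abs_le.1 (hres x)
  have h2 := abs_le.1 (hdiff x)
  exact abs_le.2 ⟨by linarith, by linarith⟩

end density

/-! ### The generator on `C²_c` -/

section generator

variable {d : ℕ} {p : CBIParams d} {P : ℝ≥0 → Kernel (Orthant d) (Orthant d)}

theorem abs_act_sub_act_le (hP : IsTransitionSemigroup P) (t : ℝ≥0) {u w : Orthant d →ᵇ ℝ}
    {η : ℝ} (H : ∀ y, |u y - w y| ≤ η) (x : Orthant d) : |act P t u x - act P t w x| ≤ η := by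
  have e := act_linComb_bcf hP t u w 1 (-1) x
  have h := abs_act_le hP t (u := fun y => 1 * u y + (-1) * w y) (M := η) (fun y => by
    convert H y using 2; ring) x
  rw [e] at h
  convert h using 2
  ring

/-- Strong continuity of the semigroup. -/
theorem exists_abs_act_sub_le (hp : p.IsAdmissible) (hP : IsTransitionSemigroup P)
    (hL : p.HasLaplace P) {g : Orthant d →ᵇ ℝ} {R : ℝ}
    (hg : ∀ x : Orthant d, R < ‖x.1‖ → g x = 0) {η : ℝ} (hη : 0 < η) :
    ∃ δ > 0, ∀ s : ℝ≥0, (s : ℝ) ≤ δ → ∀ x, |act P s g x - g x| ≤ η := by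
  obtain ⟨w, hw, h⟩ := exists_expoGraph_fst_near p hg (ε := η / 3) (by positivity)
  obtain ⟨δ, hδ, H⟩ := expansion_of_mem_expoGraph hp hP hL hw 1 one_pos
  refine ⟨min δ (η / 3 / (1 + ‖w.2‖)), by positivity, fun s hs x => ?_⟩
  have hs0 : (0 : ℝ) ≤ s := s.2
  have h1 := abs_le.1 (H s (hs.trans (min_le_left _ _)) x)
  have h2 : (s : ℝ) * (1 + ‖w.2‖) ≤ η / 3 :=
    (le_div_iff₀ (by positivity)).1 (hs.trans (min_le_right _ _))
  have h3 : |(s : ℝ) * w.2 x| ≤ s * ‖w.2‖ := by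
    rw [abs_mul, abs_of_nonneg hs0]
    exact mul_le_mul_of_nonneg_left (abs_bcf_le w.2 x) hs0
  have h3' := abs_le.1 h3
  have h4 := abs_le.1 (abs_act_sub_act_le hP s h x)
  have h5 := abs_le.1 (h x)
  exact abs_le.2 ⟨by nlinarith, by nlinarith⟩

/-- The mean value inequality for `t ↦ P_t u`, obtained by subdividing `[0, t]`. -/
theorem abs_act_sub_sub_le (hp : p.IsAdmissible) (hP : IsTransitionSemigroup P)
    (hL : p.HasLaplace P) {w : (Orthant d →ᵇ ℝ) × (Orthant d →ᵇ ℝ)} (hw : w ∈ expoGraph p)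
    {t : ℝ≥0} {η : ℝ} (H : ∀ s ≤ t, ∀ x, |act P s w.2 x - w.2 x| ≤ η) (x : Orthant d) :
    |act P t w.1 x - w.1 x - t * w.2 x| ≤ t * η := by
  have ht0 : (0 : ℝ) ≤ t := t.2
  refine le_of_forall_pos_le_add fun ε' hε' => ?_
  set ε := ε' / (t + 1) with hε
  have hε0 : 0 < ε := by positivity
  obtain ⟨δ, hδ, hexp⟩ := expansion_of_mem_expoGraph hp hP hL hw ε hε0
  obtain ⟨n, hn⟩ := exists_nat_ge ((t : ℝ) / δ)
  set h : ℝ≥0 := t / (n + 1) with hh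
  have hn1 : (0 : ℝ) < n + 1 := by positivity
  have hhr : (h : ℝ) = t / (n + 1) := by rw [hh]; push_cast; rfl
  have hh0 : (0 : ℝ) ≤ h := h.2
  have hhδ : (h : ℝ) ≤ δ := by
    rw [hhr, div_le_iff₀ hn1]
    have := (div_le_iff₀ hδ).1 hn
    nlinarith
  have hnh : ((n + 1 : ℕ) : ℝ≥0) * h = t := by
    rw [hh]; push_cast; field_simp
  have key : ∀ k : ℕ, k ≤ n + 1 →
      |act P (k * h) w.1 x - w.1 x - (k * h : ℝ≥0) * w.2 x| ≤ (k * h : ℝ≥0) * (η + ε) := by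
    intro k
    induction k with
    | zero =>
      intro _
      have : act P 0 w.1 x = w.1 x := by rw [act, hP.zero, Kernel.id_apply, integral_dirac]
      simp [this]
    | succ k ih =>
      intro hk
      have hkt : (k : ℝ≥0) * h ≤ t := by
        rw [← hnh]
        exact mul_le_mul_left (Nat.cast_le.2 (by omega)) h
      have e : ((k + 1 : ℕ) : ℝ≥0) * h = k * h + h := by push_cast; ring
      have h1 := abs_le.1 (ih (by omega))
      have h2 := abs_le.1 (abs_act_expansion_le hP h (k * h) (hexp h hhδ) x)
      have h3 : |(h : ℝ) * (act P (k * h) w.2 x - w.2 x)| ≤ h * η := by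
        rw [abs_mul, abs_of_nonneg hh0]
        exact mul_le_mul_of_nonneg_left (H _ hkt x) hh0
      have h3' := abs_le.1 h3
      rw [e, act_act hP (k * h) h (measurable_bcf w.1) (abs_bcf_le w.1), NNReal.coe_add]
      exact abs_le.2 ⟨by linarith, by linarith⟩
  have := key (n + 1) le_rfl
  rw [hnh] at this
  refine this.trans ?_
  have h4 : (t : ℝ) * ε ≤ ε' := by
    rw [hε, mul_div_assoc', div_le_iff₀ (by positivity)]
    nlinarith
  linarith

theorem exists_bcf_eq {g : EuclideanSpace ℝ (Fin d) → ℝ} (hg : ContinuousOn g (orthant d)) {R : ℝ}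
    (hR : ∀ x ∈ orthant d, R < ‖x‖ → g x = 0) : ∃ G : Orthant d →ᵇ ℝ, ∀ x, G x = g x.1 := by
  obtain ⟨M, hM⟩ := ((isCompact_closedBall (0 : EuclideanSpace ℝ (Fin d)) R).inter_left
    (isClosed_orthant d)).exists_bound_of_continuousOn (hg.mono inter_subset_left)
  refine ⟨BoundedContinuousFunction.ofNormedAddCommGroup (fun x : Orthant d => g x.1)
    (hg.comp_continuous continuous_subtype_val fun x => x.2) |M| fun x => ?_, fun x => rfl⟩
  by_cases h : R < ‖x.1‖
  · rw [hR x.1 x.2 h, norm_zero]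
    exact abs_nonneg M
  · exact (hM x.1 ⟨x.2, by simpa using h⟩).trans (le_abs_self M)

/-- A transition semigroup with the Laplace transforms of the CBI process has generator `gen` on
`C²_c`. -/
theorem CBIParams.isSemigroup_of_hasLaplace (hp : p.IsAdmissible) (hP : IsTransitionSemigroup P)
    (hL : p.HasLaplace P) : p.IsSemigroup P := by
  refine ⟨hP, fun f hf => ?_, hL⟩
  obtain ⟨R, hR⟩ := hf.exists_gen_eq_zero p
  obtain ⟨fB, hfB⟩ := exists_bcf_eq hf.smooth.continuousOn fun x hx h => (hR x hx h).1
  obtain ⟨gB, hgB⟩ := exists_bcf_eq (hf.isC2b.continuousOn_gen hp) fun x hx h => (hR x hx h).2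
  rw [Metric.tendstoUniformly_iff]
  intro ε hε
  set η := ε / 10 with hη
  have hη0 : 0 < η := by positivity
  obtain ⟨δ, hδ, hcont⟩ := exists_abs_act_sub_le hp hP hL (g := gB)
    (fun x h => by rw [hgB, (hR x.1 x.2 h).2]) hη0
  have hsmall : ∀ᶠ t : ℝ≥0 in 𝓝[>] 0, (t : ℝ) ≤ δ :=
    mem_nhdsWithin_of_mem_nhds
      ((NNReal.continuous_coe.tendsto' 0 0 rfl).eventually_le_const hδ)
  filter_upwards [hsmall, self_mem_nhdsWithin] with t ht ht0 x
  have htpos : (0 : ℝ) < t := ht0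
  -- the approximation may be chosen after the time `t`
  set κ := min η (t * η) with hκ
  have hκ1 : κ ≤ η := min_le_left _ _
  have hκ2 : κ ≤ t * η := min_le_right _ _
  obtain ⟨w, hw, hnear⟩ := exists_expoGraph_near hp hP hL hf hfB hgB (ε := κ)
    (lt_min hη0 (mul_pos htpos hη0))
  have hwcont : ∀ s ≤ t, ∀ y, |act P s w.2 y - w.2 y| ≤ 3 * η := fun s hs y => by
    have h1 := abs_le.1 (hcont s ((NNReal.coe_le_coe.2 hs).trans ht) y)
    have h2 := abs_le.1 (abs_act_sub_act_le hP s (fun z => (hnear z).2) y)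
    have h3 := abs_le.1 (hnear y).2
    exact abs_le.2 ⟨by linarith, by linarith⟩
  have h1 := abs_le.1 (abs_act_sub_sub_le hp hP hL hw hwcont x)
  have h2 := abs_le.1 (abs_act_sub_act_le hP t (fun z => (hnear z).1) x)
  have h3 := abs_le.1 (hnear x).1
  have h4 : |(t : ℝ) * (w.2 x - gB x)| ≤ t * η := by
    rw [abs_mul, abs_of_pos htpos]
    exact mul_le_mul_of_nonneg_left ((hnear x).2.trans hκ1) htpos.le
  have h4' := abs_le.1 h4
  have hmain : |act P t fB x - fB x - t * gB x| ≤ t * (6 * η) :=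
    abs_le.2 ⟨by linarith, by linarith⟩
  have hact : (∫ y : Orthant d, f y.1 ∂(P t x)) = act P t fB x :=
    integral_congr_ae (ae_of_all _ fun y => (hfB y).symm)
  rw [dist_comm, Real.dist_eq, hact, ← hfB, ← hgB]
  have hdiv : (act P t fB x - fB x) / t - gB x = (act P t fB x - fB x - t * gB x) / t := by
    field_simp
  rw [hdiv, abs_div, abs_of_pos htpos, div_lt_iff₀ htpos]
  refine hmain.trans_lt ?_
  rw [mul_comm]
  exact mul_lt_mul_of_pos_right (by rw [hη]; linarith) htpos

end generator

theorem mainTheorem5 {d : ℕ} (p : CBIParams d) (hp : p.IsAdmissible)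
    (hmom : p.MomentCondition) :
    -- the listed parameters are admissible
    p.toIS.IsAdmissible ∧
    -- coordinate vectors of the immigration superprocess are CBI processes
    (∀ (Ω : Type*) [mΩ : MeasurableSpace Ω] (Pr : Measure Ω) [IsProbabilityMeasure Pr]
      (ℱ : Filtration ℝ≥0 mΩ), UsualHypotheses Pr ℱ →
      ∀ 𝓖 : Filtration ℝ≥0 mΩ, 𝓖 ≤ ℱ →
      ∀ Y : ℝ≥0 → Ω → FiniteMeasure (Fin d),
        (∀ᵐ ω ∂Pr, IsCadlag fun t => Y t ω) →
        p.toIS.IsSuperprocess Pr 𝓖 Y →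
        ∫⁻ ω, ((Y 0 ω).mass : ℝ≥0∞) ∂Pr < ∞ →
        p.IsCBI Pr 𝓖 (fun t ω => toVec (Y t ω)) ∧
          ∫⁻ ω, ENNReal.ofReal ‖(toVec (Y 0 ω)).1‖ ∂Pr < ∞) ∧
    -- the generator can be written in the alternative form, in which all integrals converge
    (∀ f : EuclideanSpace ℝ (Fin d) → ℝ, IsC2c f → ∀ x ∈ orthant d,
      Integrable (fun z : UPos d => f (x + z.1) - f x) p.ν ∧
      (∀ i, Integrable
        (fun z : UPos d => f (x + z.1) - f x - pd f i x * min 1 (z.1 i)) (p.μ i)) ∧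
      (∀ i, Integrable
        (fun z : UPos d => f (x + z.1) - f x - ∑ j, z.1 j * pd f j x) (p.μ i)) ∧
      (∀ i j, Integrable
        (fun z : UPos d => max (z.1 i - if i = j then 1 else 0) 0) (p.μ j)) ∧
      p.gen f x = p.genAlt f x) := by
  refine ⟨hp.toIS_isAdmissible hmom, ?_, fun f hf x hx => ?_⟩
  · intro Ω _ Pr _ ℱ _ 𝓖 _ Y _ hY hmass
    obtain ⟨Q, hQ, hYQ⟩ := hY
    refine ⟨⟨CBIParams.toOrthant Q, ?_, CBIParams.isMarkovProcess_toOrthant hYQ⟩, ?_⟩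
    · exact CBIParams.isSemigroup_of_hasLaplace hp
        (CBIParams.isTransitionSemigroup_toOrthant hQ.semigroup) (hp.laplace_toOrthant hQ)
    · refine (lintegral_mono fun ω => ?_).trans_lt hmass
      rw [← ENNReal.ofReal_coe_nnreal]
      exact ENNReal.ofReal_le_ofReal (norm_toVec_le_mass _)
  · exact ⟨hf.isC2b.integrable_immigration hp hx, hf.isC2b.integrable_branching hp hx,
      hf.isC2b.integrable_taylor hp hx, hp.integrable_max, hf.isC2b.gen_eq_genAlt hp hx⟩
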